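/- Let $\mathbb F$ be a field and let $0\neq q\in\mathbb F$ be not a root of unity. Write $[X,Y]=XY-YX$ and $[X,Y]_c=cXY-c^{-1}YX$. The $q$-Onsager algebra $\mathcal O_q$ is the associative unital $\mathbb F$-algebra with generators $A,A^*$ and relations $$[A,[A,[A,A^*]_q]_{q^{-1}}]=(q^2-q^{-2})^2[A^*,A],\qquad [A^*,[A^*,[A^*,A]_q]_{q^{-1}}]=(q^2-q^{-2})^2[A,A^*].$$ Put $$L(A^*)=A^*+\frac{[A,[A,A^*]_q]}{(q-q^{-1})(q^2-q^{-2})}\in\mathcal O_q$$ (the image of $A^*$ under the Lusztig automorphism $L$ of $\mathcal O_q$, which fixes $A$). Let $V$ be an irreducible $\mathcal O_q$-module with $2\le\dim_{\mathbb F} V<\infty$ on which each of $A,A^*$ is diagonalizable. Call distinct scalars $\lambda,\mu$ adjacent if $\lambda^2-(q^2+q^{-2})\lambda\mu+\mu^2+(q^2-q^{-2})^2=0$. Let $\theta_0,\dots,\theta_d$ (resp. $\theta^*_0,\dots,\theta^*_\delta$) be an ordering of the distinct eigenvalues of $A$ (resp. $A^*$) on $V$ in which consecutive eigenvalues are adjacent.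 Let $V_i$, $V_i^*$, $V_i^+$ be the eigenspaces on $V$ of $A$, $A^*$, $L(A^*)$ for the scalars $\theta_i$, $\theta^*_i$, $\theta_i^*$ respectively. A decomposition of $V$ is a sequence $W_0,\dots,W_d$ of nonzero subspaces whose direct sum is $V$; its inversion is $W_d,\dots,W_0$, and its corresponding map is the $X\in\mathrm{End}(V)$ that acts on $W_i$ as $q^{d-2i}$ for $0\le i\le d$. Two decompositions $W$, $W'$ meet at their starting points if $W_0+\cdots+W_i=W'_0+\cdots+W'_i$ for $0\le i\le d$. Then $\delta=d$, each of $\{V_i\}$, $\{V_i^*\}$, $\{V_i^+\}$ $(0\le i\le d)$ is a decomposition of $V$, and there is a nonzero $a\in\mathbb F$ with $a\ne a^{-1}$ and $\theta_i=aq^{d-2i}+a^{-1}q^{2i-d}$ $(0\le i\le d)$ such that the following holds. Take six vertices, the end points of three horizontal segments: $t_\ell,t_r$ (segment $A^*$), $m_\ell,m_r$ (segment $A$), $b_\ell,b_r$ (segment $L(A^*)$). To $t_\ell,m_\ell,b_\ell$ assign the decompositions $\{V^*_i\}$, $\{V_i\}$, $\{V^+_i\}$, and to $t_r,m_r,b_r$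 their inversions. An oriented edge $x\to y$ represents the map $X$ if $X$ corresponds to a decomposition $W$ such that $W$ and the decomposition assigned to $x$ meet at their starting points, and the inversion of $W$ and the decomposition assigned to $y$ meet at their starting points. Each of $t_\ell\to m_r$, $t_\ell\to m_\ell$, $t_r\to m_r$, $t_r\to m_\ell$ represents a map; call these $K$, $B$, $K^\downarrow$, $B^\downarrow$ respectively. These are invertible, and so are $$N=\frac{a^{-1}K^{-1}-aB^{-1}}{a^{-1}-a},\qquad N^\downarrow=\frac{a^{-1}(K^\downarrow)^{-1}-a(B^\downarrow)^{-1}}{a^{-1}-a}.$$ Consider the diagram with the following ten oriented edges; each of them represents exactly one map, as listed: - $m_r\to t_\ell$: $K^{-1}$; $\quad m_\ell\to t_\ell$: $B^{-1}$; $\quad m_r\to t_r$: $(K^\downarrow)^{-1}$; $\quad m_\ell\to t_r$: $(B^\downarrow)^{-1}$; - $b_\ell\to m_r$: $a^{-1}A-a^{-2}K^{-1}$; $\quad b_\ell\to m_\ell$: $aA-a^2B^{-1}$; $\quad b_r\to m_r$: $a^{-1}A-a^{-2}(K^\downarrow)^{-1}$; $\quad b_r\to m_\ell$: $aA-a^2(B^\downarrow)^{-1}$;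 - $t_\ell\to b_\ell$: $N^{-1}$; $\quad t_r\to b_r$: $(N^\downarrow)^{-1}$. This diagram has exactly four oriented 3-cycles (up to rotation). For each oriented 3-cycle $x\to y\to z\to x$, the maps $X,Y,Z$ represented by $x\to y$, $y\to z$, $z\to x$ form an equitable triple: $X,Y,Z$ are invertible and $$\frac{qXY-q^{-1}YX}{q-q^{-1}}=I,\qquad \frac{qYZ-q^{-1}ZY}{q-q^{-1}}=I,\qquad \frac{qZX-q^{-1}XZ}{q-q^{-1}}=I.$$ For example, $K^{-1},\ N^{-1},\ a^{-1}A-a^{-2}K^{-1}$ is an equitable triple. -/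

import Mathlib

/-- The commutator `[X, Y] = XY - YX`. -/
def ringComm {R : Type*} [Ring R] (X Y : R) : R := X * Y - Y * X

/-- The `c`-commutator `[X, Y]_c = c XY - c⁻¹ YX`. -/
def qComm {F R : Type*} [Field F] [Ring R] [Algebra F R] (c : F) (X Y : R) : R :=
  c • (X * Y) - c⁻¹ • (Y * X)

/-- The two q-Dolan/Grady relations, imposed on the free algebra with generators
`0` (for `A`) and `1` (for `A*`). -/
inductive DolanGradyRel (F : Type*) [Field F] (q : F) :
    FreeAlgebra F (Fin 2) → FreeAlgebra F (Fin 2) → Prop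
  | first : DolanGradyRel F q
      (ringComm (FreeAlgebra.ι F 0) (qComm q⁻¹ (FreeAlgebra.ι F 0)
        (qComm q (FreeAlgebra.ι F 0) (FreeAlgebra.ι F 1))))
      ((q ^ 2 - (q ^ 2)⁻¹) ^ 2 • ringComm (FreeAlgebra.ι F 1) (FreeAlgebra.ι F 0))
  | second : DolanGradyRel F q
      (ringComm (FreeAlgebra.ι F 1) (qComm q⁻¹ (FreeAlgebra.ι F 1)
        (qComm q (FreeAlgebra.ι F 1) (FreeAlgebra.ι F 0))))
      ((q ^ 2 - (q ^ 2)⁻¹) ^ 2 • ringComm (FreeAlgebra.ι F 0) (FreeAlgebra.ι F 1))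

/-- The q-Onsager algebra: the associative unital `F`-algebra with generators `A`, `A*`
and the q-Dolan/Grady relations. -/
abbrev QOnsager (F : Type*) [Field F] (q : F) : Type _ := RingQuot (DolanGradyRel F q)

namespace QOnsager

variable {F : Type*} [Field F]

/-- The generator `A`. -/
noncomputable def A (q : F) : QOnsager F q :=
  RingQuot.mkAlgHom F (DolanGradyRel F q) (FreeAlgebra.ι F 0)

/-- The generator `A*`. -/
noncomputable def Astar (q : F) : QOnsager F q :=
  RingQuot.mkAlgHom F (DolanGradyRel F q) (FreeAlgebra.ι F 1)

/-- The image `L(A*)` of `A*` under the Lusztig automorphism `L`, which fixes `A`: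
`L(A*) = A* + [A, [A, A*]_q] / ((q - q⁻¹)(q² - q⁻²))`. -/
noncomputable def LAstar (q : F) : QOnsager F q :=
  Astar q + ((q - q⁻¹) * (q ^ 2 - (q ^ 2)⁻¹))⁻¹ • ringComm (A q) (qComm q (A q) (Astar q))

/-- The action of an element of the q-Onsager algebra on a module, as an element of `End(V)`. -/
noncomputable def act {q : F} (V : Type*) [AddCommGroup V] [Module F V]
    [Module (QOnsager F q) V] [IsScalarTower F (QOnsager F q) V] (x : QOnsager F q) :
    Module.End F V :=
  Algebra.lsmul F F V x

end QOnsager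

namespace OnsagerDiagram

variable {F V : Type*} [Field F] [AddCommGroup V] [Module F V]

/-- `V` is spanned by the eigenvectors of `T`. -/
def IsDiagonalizable (T : Module.End F V) : Prop :=
  ⨆ μ : F, T.eigenspace μ = ⊤

/-- The polynomial `P(λ, μ) = λ² - (q² + q⁻²)λμ + μ² + (q² - q⁻²)²`. Distinct eigenvalues
`λ`, `μ` are called adjacent whenever `P(λ, μ) = 0`. -/
def adjPoly (q x y : F) : F :=
  x ^ 2 - (q ^ 2 + (q ^ 2)⁻¹) * x * y + y ^ 2 + (q ^ 2 - (q ^ 2)⁻¹) ^ 2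

/-- `θ 0, …, θ d` is an ordering (without repetition) of the set of eigenvalues of `T`,
in which consecutive eigenvalues are adjacent. Values `θ i` with `i > d` are irrelevant. -/
structure IsStandardOrdering (q : F) (T : Module.End F V) (d : ℕ) (θ : ℕ → F) : Prop where
  hasEigenvalue : ∀ i ≤ d, T.HasEigenvalue (θ i)
  exhausts : ∀ μ : F, T.HasEigenvalue μ → ∃ i ≤ d, θ i = μ
  injective : ∀ i ≤ d, ∀ j ≤ d, θ i = θ j → i = j
  adjacent : ∀ i < d, adjPoly q (θ i) (θ (i + 1)) = 0

/-- `W 0, …, W d` are nonzero subspaces whose direct sum is `V`. -/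
def IsDecomposition (d : ℕ) (W : ℕ → Submodule F V) : Prop :=
  (∀ i ≤ d, W i ≠ ⊥) ∧ DirectSum.IsInternal (fun i : Fin (d + 1) => W i)

/-- The inversion `W d, …, W 0` of the sequence `W 0, …, W d`. -/
def inversion (d : ℕ) (W : ℕ → Submodule F V) : ℕ → Submodule F V := fun i => W (d - i)

/-- The sum `W 0 + W 1 + ⋯ + W i`. -/
def initialSum (W : ℕ → Submodule F V) (i : ℕ) : Submodule F V :=
  ⨆ j ∈ Finset.range (i + 1), W j

/-- The line segments of `W` and `W'` meet at their starting points: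
`W 0 + ⋯ + W i = W' 0 + ⋯ + W' i` for `0 ≤ i ≤ d`. -/
def SameStart (d : ℕ) (W W' : ℕ → Submodule F V) : Prop :=
  ∀ i ≤ d, initialSum W i = initialSum W' i

/-- `X` is the map corresponding to the decomposition `W`: it acts on `W i` as `q^(d-2i)`. -/
def IsCorrespondingMap (q : F) (d : ℕ) (W : ℕ → Submodule F V) (X : Module.End F V) : Prop :=
  ∀ i ≤ d, ∀ w ∈ W i, X w = q ^ ((d : ℤ) - 2 * (i : ℤ)) • w

/-- The three horizontal line segments, labelled `A*` (top), `A` (middle), `L(A*)` (bottom),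
have six end points. -/
inductive Vertex
  | topLeft | topRight | midLeft | midRight | botLeft | botRight
  deriving DecidableEq

/-- The sequence of eigenspaces of `T` for the scalars `θ 0, θ 1, …`. -/
def eigenspaceSeq (T : Module.End F V) (θ : ℕ → F) : ℕ → Submodule F V :=
  fun i => T.eigenspace (θ i)

/-- The decomposition given by the horizontal line segment through a vertex, read starting from
that vertex. Here `Vm`, `Vs`, `Vp` are the eigenspace decompositions of `A`, `A*`, `L(A*)`. -/
def startingAt (d : ℕ) (Vm Vs Vp : ℕ → Submodule F V) : Vertex → ℕ → Submodule F V
  | .topLeft => Vs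
  | .topRight => inversion d Vs
  | .midLeft => Vm
  | .midRight => inversion d Vm
  | .botLeft => Vp
  | .botRight => inversion d Vp

/-- Given the decompositions `D x` starting at the vertices `x`, the map `X` is the map
represented by the oriented edge from `x` to `y`: it corresponds to a decomposition that meets
`D x` at its start and whose inversion meets `D y` at its start. -/
def IsEdgeMap (q : F) (d : ℕ) (D : Vertex → ℕ → Submodule F V) (x y : Vertex)
    (X : Module.End F V) : Prop :=
  ∃ W : ℕ → Submodule F V, IsDecomposition d W ∧ SameStart d W (D x) ∧
    SameStart d (inversion d W) (D y) ∧ IsCorrespondingMap q d W X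

/-- The oriented edges of the diagram (the horizontal segments carry no orientation). -/
inductive Edge : Vertex → Vertex → Prop
  | midLeft_topLeft : Edge .midLeft .topLeft
  | midRight_topLeft : Edge .midRight .topLeft
  | midLeft_topRight : Edge .midLeft .topRight
  | midRight_topRight : Edge .midRight .topRight
  | botLeft_midLeft : Edge .botLeft .midLeft
  | botLeft_midRight : Edge .botLeft .midRight
  | botRight_midLeft : Edge .botRight .midLeft
  | botRight_midRight : Edge .botRight .midRight
  | topLeft_botLeft : Edge .topLeft .botLeft
  | topRight_botRight : Edge .topRight .botRight

/-- `x → y → z → x` is an oriented 3-cycle of the diagram. -/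
def IsOrientedThreeCycle (x y z : Vertex) : Prop := Edge x y ∧ Edge y z ∧ Edge z x

/-- The map `(a⁻¹ K⁻¹ - a B⁻¹) / (a⁻¹ - a)`; for `K`, `B` it is `N`, and for `K↓`, `B↓` it
is `N↓`. -/
noncomputable def mapN (a : F) (K B : Module.End F V) : Module.End F V :=
  (a⁻¹ - a)⁻¹ • (a⁻¹ • Ring.inverse K - a • Ring.inverse B)

/-- The maps attached to the oriented edges of the diagram; `Kd`, `Bd` stand for `K↓`, `B↓`.
The value at a pair of vertices that is not an edge is irrelevant. -/
noncomputable def edgeLabel (a : F) (A K B Kd Bd : Module.End F V) :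
    Vertex → Vertex → Module.End F V
  | .midLeft, .topLeft => Ring.inverse B
  | .midRight, .topLeft => Ring.inverse K
  | .midLeft, .topRight => Ring.inverse Bd
  | .midRight, .topRight => Ring.inverse Kd
  | .botLeft, .midLeft => a • A - a ^ 2 • Ring.inverse B
  | .botLeft, .midRight => a⁻¹ • A - (a ^ 2)⁻¹ • Ring.inverse K
  | .botRight, .midLeft => a • A - a ^ 2 • Ring.inverse Bd
  | .botRight, .midRight => a⁻¹ • A - (a ^ 2)⁻¹ • Ring.inverse Kd
  | .topLeft, .botLeft => Ring.inverse (mapN a K B)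
  | .topRight, .botRight => Ring.inverse (mapN a Kd Bd)
  | _, _ => 0

/-- The q-Weyl relation `(q XY - q⁻¹ YX) / (q - q⁻¹) = I`. -/
def QWeyl (q : F) (X Y : Module.End F V) : Prop :=
  (q - q⁻¹)⁻¹ • (q • (X * Y) - q⁻¹ • (Y * X)) = 1

/-- An equitable triple on `V`. -/
def IsEquitableTriple (q : F) (X Y Z : Module.End F V) : Prop :=
  IsUnit X ∧ IsUnit Y ∧ IsUnit Z ∧ QWeyl q X Y ∧ QWeyl q Y Z ∧ QWeyl q Z X

end OnsagerDiagram

/-! Everything is phrased through flags. Let `G` be the flag of partial sums of eigenspaces of A*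
read from one end, and `H`, `H'` the flags of A read from its two ends. By the q-Dolan/Grady
relations each of A, A* acts on the eigenspaces of the other in a tridiagonal way
(`DolanGrady.mem_nearSum`), so it raises the other's flags by at most one step. The sum of all `G n
⊓ H m` with `n + m` fixed is then stable under both, and irreducibility makes `G` and `H` opposite
(`IsTridiagonal.isCompl`). An oriented edge amounts to an operator that is triangular on two flags
with mutually inverse weights (`Links`). Such an operator is unique, and for opposite flags it
exists; this yields K and B. Comparing A with K on the weight spaces of K gives qKA - q⁻¹AK = (q -
q⁻¹)(aK² + a⁻¹), and K⁻¹ satisfies the analogous relation with A*.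

Two further facts carry the theorem. First, a certain quadratic expression in K and B vanishes
(`splitQuadratic_eq_zero`): the smallest K,B-stable subspace containing its range is stable under A
and A*, yet lies in a proper term of the flag `G` that K and B share. Second, the Lusztig
automorphism is implemented on V by an invertible Ψ commuting with A (`lusztig_conj`), and
conjugation by Ψ sends K to a⁻¹A - a⁻²K⁻¹ (`conj_eq_shift`). Hence the flags of L(A*) are the images
under Ψ of those of A*, and the labels of the edges leaving the bottom segment are conjugates of K
and B. The map N is a normalized combination of K⁻¹ and B⁻¹, and also of their bottom counterparts
because A cancels, so it links the bottom flag to the top one.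

Of the three q-Weyl relations in a triangle, one is the relation between K and A rewritten; the
other two are the quadratic relation for the Ψ-conjugates of K, B and for K⁻¹, B⁻¹. Exchanging a
with a⁻¹ swaps K and B; exchanging b with b⁻¹ passes from the left half of the diagram to the right
half. -/

namespace OnsagerDiagram

/-! ### Operators triangular on a flag -/

section Triangular

variable {F V : Type*} [Field F] [AddCommGroup V] [Module F V]

/-- The sum `W 0 + ⋯ + W (n - 1)`. -/
def partialSum (W : ℕ → Submodule F V) (n : ℕ) : Submodule F V := ⨆ j ∈ Finset.range n, W j

/-- An increasing sequence of subspaces from `0` to `V`, constant beyond `d + 1`. -/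
structure IsFlag (d : ℕ) (H : ℕ → Submodule F V) : Prop where
  zero : H 0 = ⊥
  mono : Monotone H
  top : ∀ n, d < n → H n = ⊤

/-- `T` acts on `H (n + 1) / H n` as the scalar `l n`. -/
def Triangular (H : ℕ → Submodule F V) (l : ℕ → F) (T : Module.End F V) : Prop :=
  ∀ n, ∀ v ∈ H (n + 1), T v - l n • v ∈ H n

variable {d : ℕ} {H : ℕ → Submodule F V} {l m : ℕ → F} {T S : Module.End F V}

namespace Triangular

/-- Scalars with index above `d` are immaterial, since the flag is already `V` there. -/
theorem congr (hH : IsFlag d H) (hT : Triangular H l T) (h : ∀ n ≤ d, l n = m n) :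
    Triangular H m T := by
  intro n v hv
  rcases le_or_gt n d with hn | hn
  · rw [← h n hn]; exact hT n v hv
  · rw [hH.top n hn]; trivial

theorem mapsTo (hH : IsFlag d H) (hT : Triangular H l T) {n : ℕ} {v : V} (hv : v ∈ H n) :
    T v ∈ H n := by
  cases n with
  | zero => rw [hH.zero, Submodule.mem_bot] at hv ⊢; simp [hv]
  | succ n =>
    have h := Submodule.add_mem _ (hH.mono n.le_succ (hT n v hv))
      (Submodule.smul_mem _ (l n) hv)
    simpa using h

/-- On `H n` the operator `T - μ` has the nonzero diagonal entries `l i - μ`, hence is injective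
there; `exists_preimage` is the matching surjectivity. Neither needs a basis. -/
theorem eq_zero_of_eigen (hH : IsFlag d H) (hT : Triangular H l T) {n : ℕ} {μ : F}
    (hμ : ∀ i < n, l i ≠ μ) {v : V} (hv : v ∈ H n) (h : T v = μ • v) : v = 0 := by
  induction n with
  | zero => simpa [hH.zero] using hv
  | succ n ih =>
    refine ih (fun i hi => hμ i (by omega)) ?_
    have h1 := hT n v hv
    rw [h, ← sub_smul] at h1
    exact (Submodule.smul_mem_iff _ (sub_ne_zero.2 (hμ n n.lt_succ_self).symm)).1 h1

theorem exists_preimage (hH : IsFlag d H) (hT : Triangular H l T) {n : ℕ} {μ : F}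
    (hμ : ∀ i < n, l i ≠ μ) {y : V} (hy : y ∈ H n) : ∃ h ∈ H n, T h - μ • h = y := by
  induction n generalizing y with
  | zero =>
    rw [hH.zero, Submodule.mem_bot] at hy
    exact ⟨0, Submodule.zero_mem _, by simp [hy]⟩
  | succ n ih =>
    have hne : l n - μ ≠ 0 := sub_ne_zero.2 (hμ n n.lt_succ_self)
    obtain ⟨h, hh, he⟩ := ih (fun i hi => hμ i (by omega))
      (Submodule.smul_mem _ (l n - μ)⁻¹ (hT n y hy))
    refine ⟨(l n - μ)⁻¹ • y - h, Submodule.sub_mem _ (Submodule.smul_mem _ _ hy)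
      (hH.mono n.le_succ hh), ?_⟩
    have : (l n - μ)⁻¹ • (l n - μ) • y = y := inv_smul_smul₀ hne y
    calc T ((l n - μ)⁻¹ • y - h) - μ • ((l n - μ)⁻¹ • y - h)
        = (l n - μ)⁻¹ • T y - μ • (l n - μ)⁻¹ • y - (T h - μ • h) := by
          simp only [map_sub, map_smul]; module
      _ = (l n - μ)⁻¹ • (l n - μ) • y := by rw [he]; module
      _ = y := this

/-- `T - l n` sends `v` into `H n` and maps `H n` onto itself, so a correction from `H n` turns `v`
into an eigenvector. -/
theorem exists_eigenvector (hH : IsFlag d H) (hT : Triangular H l T) {n : ℕ}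
    (hl : ∀ i < n, l i ≠ l n) {v : V} (hv : v ∈ H (n + 1)) :
    ∃ w, T w = l n • w ∧ w - v ∈ H n := by
  obtain ⟨h, hh, he⟩ := hT.exists_preimage hH hl (hT n v hv)
  refine ⟨v - h, ?_, by simpa using hh⟩
  rw [map_sub, smul_sub]
  have : T h = T v - l n • v + l n • h := by rw [← he]; abel
  rw [this]; abel

/-- Distinct diagonal scalars let the flag be recovered from `T`; this is the passage from flags
back to decompositions. -/
theorem eq_partialSum (hH : IsFlag d H) (hT : Triangular H l T)
    (hl : ∀ i j, i < j → j ≤ d → l i ≠ l j) {n : ℕ} (hn : n ≤ d + 1) :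
    H n = partialSum (fun i => T.eigenspace (l i)) n := by
  induction n with
  | zero => simp [hH.zero, partialSum]
  | succ n ih =>
    have ih' := ih (by omega)
    rw [partialSum, Finset.range_add_one, Finset.iSup_insert]
    change H (n + 1) = T.eigenspace (l n) ⊔ partialSum (fun i => T.eigenspace (l i)) n
    rw [← ih']
    apply le_antisymm
    · intro v hv
      obtain ⟨w, hw, hwv⟩ := hT.exists_eigenvector hH (fun i hi => hl i n hi (by omega)) hv
      have : v = w + -(w - v) := by abel
      rw [this]
      exact Submodule.add_mem_sup (Module.End.mem_eigenspace_iff.2 hw) (Submodule.neg_mem _ hwv)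
    · refine sup_le ?_ (hH.mono n.le_succ)
      intro w hw
      rw [Module.End.mem_eigenspace_iff] at hw
      -- An eigenvector for `l n` descends the flag: on `H (k + 1) / H k` the operator is `l k ≠ l
      -- n`, so membership in `H (k + 1)` forces membership in `H k`.
      have key : ∀ k, n + 1 ≤ k → k ≤ d + 1 → w ∈ H k → w ∈ H (n + 1) := by
        intro k hk
        induction k, hk using Nat.le_induction with
        | base => intro _ h; exact h
        | succ k hk ihk =>
          intro hkd hwk
          refine ihk (by omega) ?_
          have h1 := hT k w hwk
          rw [hw, ← sub_smul] at h1
          exact (Submodule.smul_mem_iff _ (sub_ne_zero.2 (hl n k (by omega) (by omega)))).1 h1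
      exact key (d + 1) hn le_rfl (by rw [hH.top _ d.lt_succ_self]; trivial)

theorem eigenspace_le (hH : IsFlag d H) (hT : Triangular H l T)
    (hl : ∀ i j, i < j → j ≤ d → l i ≠ l j) {n : ℕ} (hn : n ≤ d) {v : V}
    (hv : T v = l n • v) : v ∈ H (n + 1) := by
  rw [hT.eq_partialSum hH hl (by omega)]
  exact Submodule.mem_iSup_of_mem n (Submodule.mem_iSup_of_mem
    (Finset.mem_range.2 n.lt_succ_self) (Module.End.mem_eigenspace_iff.2 hv))

theorem ext_on_eigenvectors (hH : IsFlag d H) (hT : Triangular H l T)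
    (hl : ∀ i j, i < j → j ≤ d → l i ≠ l j) {X Y : Module.End F V}
    (h : ∀ n ≤ d, ∀ v, T v = l n • v → X v = Y v) : X = Y := by
  have h1 := hT.eq_partialSum hH hl le_rfl
  rw [hH.top _ d.lt_succ_self] at h1
  have h2 : (⊤ : Submodule F V) ≤ LinearMap.eqLocus X Y := by
    rw [h1]
    refine iSup₂_le fun n hn v hv => ?_
    exact h n (Nat.lt_succ_iff.1 (Finset.mem_range.1 hn)) v (Module.End.mem_eigenspace_iff.1 hv)
  ext v
  exact h2 (Submodule.mem_top : v ∈ ⊤)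

theorem smul (hT : Triangular H l T) (x : F) : Triangular H (fun n => x * l n) (x • T) := by
  intro n v hv
  have := Submodule.smul_mem _ x (hT n v hv)
  rwa [smul_sub, smul_smul] at this

theorem sub (hT : Triangular H l T) (hS : Triangular H m S) :
    Triangular H (fun n => l n - m n) (T - S) := by
  intro n v hv
  have := Submodule.sub_mem _ (hT n v hv) (hS n v hv)
  have e : (T - S) v - (l n - m n) • v = T v - l n • v - (S v - m n • v) := by
    rw [LinearMap.sub_apply]; module
  rwa [e]

theorem isUnit [FiniteDimensional F V] (hH : IsFlag d H) (hT : Triangular H l T)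
    (hl : ∀ n ≤ d, l n ≠ 0) : IsUnit T := by
  rw [LinearMap.isUnit_iff_ker_eq_bot, LinearMap.ker_eq_bot']
  intro v hv
  refine hT.eq_zero_of_eigen hH (n := d + 1) (μ := 0) (fun i hi => hl i (by omega)) ?_ (by simpa)
  rw [hH.top _ d.lt_succ_self]; trivial

theorem inverse (hH : IsFlag d H) (hT : Triangular H l T) (hl : ∀ n, l n ≠ 0)
    (h : S * T = 1) : Triangular H (fun n => (l n)⁻¹) S := by
  have h' : ∀ v, S (T v) = v := fun v => by
    rw [← Module.End.mul_apply, h, Module.End.one_apply]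
  have step : ∀ n, (∀ v ∈ H n, S v ∈ H n) → ∀ v ∈ H (n + 1), S v - (l n)⁻¹ • v ∈ H n := by
    intro n hn v hv
    have h1 := Submodule.smul_mem _ (-(l n)⁻¹) (hn _ (hT n v hv))
    have e : S v - (l n)⁻¹ • v = -(l n)⁻¹ • S (T v - l n • v) := by
      rw [map_sub, map_smul, h', smul_sub, smul_smul, neg_mul, inv_mul_cancel₀ (hl n)]
      module
    rwa [e]
  have stable : ∀ n, ∀ v ∈ H n, S v ∈ H n := by
    intro n
    induction n with
    | zero =>
      intro v hv
      rw [hH.zero, Submodule.mem_bot] at hv ⊢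
      simp [hv]
    | succ n ih =>
      intro v hv
      have := Submodule.add_mem _ (hH.mono n.le_succ (step n ih v hv))
        (Submodule.smul_mem _ (l n)⁻¹ hv)
      simpa using this
  exact fun n => step n (stable n)

theorem conj (hT : Triangular H l T) {Ψ : Module.End F V} (h : Ψ * T = S * Ψ) :
    Triangular (fun n => (H n).map Ψ) l S := by
  rintro n _ ⟨v, hv, rfl⟩
  refine ⟨T v - l n • v, hT n v hv, ?_⟩
  have : Ψ (T v) = S (Ψ v) := LinearMap.congr_fun h v
  rw [map_sub, map_smul, this]

end Triangular

theorem partialSum_mono (W : ℕ → Submodule F V) : Monotone (partialSum W) := fun _ _ h =>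
  biSup_mono fun _ hj => Finset.mem_range.2 ((Finset.mem_range.1 hj).trans_le h)

theorem le_partialSum (W : ℕ → Submodule F V) {i n : ℕ} (h : i < n) : W i ≤ partialSum W n :=
  le_iSup₂_of_le i (Finset.mem_range.2 h) le_rfl

theorem partialSum_eq_iSup_fin (W : ℕ → Submodule F V) (d : ℕ) :
    partialSum W (d + 1) = ⨆ i : Fin (d + 1), W i := by
  apply le_antisymm
  · exact iSup₂_le fun j hj => le_iSup (fun i : Fin (d + 1) => W i) ⟨j, Finset.mem_range.1 hj⟩
  · exact iSup_le fun i => le_partialSum W i.2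

theorem IsDecomposition.isFlag {W : ℕ → Submodule F V} (hW : IsDecomposition d W) :
    IsFlag d (partialSum W) where
  zero := by simp [partialSum]
  mono := partialSum_mono W
  top n hn := top_le_iff.1 <| by
    rw [← hW.2.submodule_iSup_eq_top, ← partialSum_eq_iSup_fin]
    exact partialSum_mono W hn

theorem IsDecomposition.not_le {W : ℕ → Submodule F V} (hW : IsDecomposition d W) {n : ℕ}
    (hn : n ≤ d) : ¬ partialSum W (n + 1) ≤ partialSum W n := by
  intro h
  have hind := hW.2.submodule_iSupIndep ⟨n, by omega⟩
  apply hW.1 n hn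
  rw [eq_bot_iff]
  refine hind le_rfl (((le_partialSum W n.lt_succ_self).trans h).trans ?_)
  refine iSup₂_le fun j hj => ?_
  have hj' := Finset.mem_range.1 hj
  refine le_iSup₂_of_le (⟨j, by omega⟩ : Fin (d + 1)) ?_ le_rfl
  intro he
  exact absurd (Fin.mk.inj_iff.1 he) (by omega)

theorem IsDecomposition.triangular {W : ℕ → Submodule F V} (hW : IsDecomposition d W)
    (h : ∀ i ≤ d, ∀ v ∈ W i, T v = l i • v) : Triangular (partialSum W) l T := by
  intro n v hv
  rcases le_or_gt n d with hn | hn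
  · have : partialSum W (n + 1) ≤ (partialSum W n).comap (T - l n • 1) := by
      refine iSup₂_le fun j hj w hw => ?_
      have hj' := Finset.mem_range.1 hj
      have e : (T - l n • (1 : Module.End F V)) w = (l j - l n) • w := by
        simp [h j (by omega) w hw, sub_smul]
      rw [Submodule.mem_comap, e]
      rcases Nat.lt_succ_iff_lt_or_eq.1 hj' with h1 | rfl
      · exact Submodule.smul_mem _ _ (le_partialSum W h1 hw)
      · simp
    simpa using this hv
  · rw [hW.isFlag.top n hn]; trivial

theorem IsDecomposition.inversion {W : ℕ → Submodule F V} (hW : IsDecomposition d W) :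
    IsDecomposition d (inversion d W) := by
  refine ⟨fun i _ => hW.1 _ (Nat.sub_le _ _), ?_⟩
  have e : (fun i : Fin (d + 1) => OnsagerDiagram.inversion d W i) =
      (fun i : Fin (d + 1) => W i) ∘ Fin.rev := by
    funext i
    simp only [OnsagerDiagram.inversion, Function.comp, Fin.val_rev]
    congr 1
    omega
  rw [DirectSum.isInternal_submodule_iff_iSupIndep_and_iSup_eq_top, e]
  refine ⟨hW.2.submodule_iSupIndep.comp Fin.rev_injective, ?_⟩
  rw [← hW.2.submodule_iSup_eq_top]
  exact Fin.revPerm.iSup_comp (g := fun i : Fin (d + 1) => W i)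

end Triangular

end OnsagerDiagram

namespace OnsagerDiagram

/-! ### Operators linking two flags, and oriented edges -/

section Links

variable {F V : Type*} [Field F] [AddCommGroup V] [Module F V]

/-- The weight `q^(d - 2n)`. -/
def weight (q : F) (d n : ℕ) : F := q ^ ((d : ℤ) - 2 * (n : ℤ))

theorem zpow_ne_of_not_root_of_unity {q : F} (hq0 : q ≠ 0) (hq : ∀ n : ℕ, 0 < n → q ^ n ≠ 1)
    {m n : ℤ} (h : q ^ m = q ^ n) : m = n := by
  have key : ∀ k : ℤ, 0 < k → q ^ k ≠ 1 := by
    intro k hk h1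
    lift k to ℕ using hk.le
    exact hq k (by exact_mod_cast hk) (by exact_mod_cast h1)
  have h1 : q ^ (m - n) = 1 := by rw [zpow_sub₀ hq0, h, div_self (zpow_ne_zero _ hq0)]
  rcases lt_trichotomy (m - n) 0 with h2 | h2 | h2
  · refine absurd ?_ (key (-(m - n)) (by omega))
    rw [zpow_neg, h1, inv_one]
  · omega
  · exact absurd h1 (key _ h2)

section weight

variable {q : F} (hq0 : q ≠ 0)
include hq0

theorem weight_ne_zero (d n : ℕ) : weight q d n ≠ 0 := zpow_ne_zero _ hq0

theorem weight_succ (d n : ℕ) : weight q d n = q ^ 2 * weight q d (n + 1) := by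
  rw [weight, weight, ← zpow_natCast, ← zpow_add₀ hq0]
  congr 1; push_cast; ring

omit hq0 in
theorem weight_inv (d n : ℕ) : (weight q d n)⁻¹ = q ^ (2 * (n : ℤ) - (d : ℤ)) := by
  rw [weight, ← zpow_neg]; congr 1; ring

omit hq0 in
theorem weight_sub {d n : ℕ} (h : n ≤ d) : weight q d (d - n) = (weight q d n)⁻¹ := by
  rw [weight_inv, weight]; congr 1; push_cast [h]; ring

variable (hq : ∀ n : ℕ, 0 < n → q ^ n ≠ 1)
include hq

theorem weight_injective {d m n : ℕ} (h : weight q d m = weight q d n) : m = n := by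
  have := zpow_ne_of_not_root_of_unity hq0 hq h
  omega

theorem weight_eq_inv {d m n : ℕ} (h : weight q d m = (weight q d n)⁻¹) : m + n = d := by
  rw [weight_inv] at h
  have := zpow_ne_of_not_root_of_unity hq0 hq h
  omega

end weight

/-- `X` acts with weights `q^(d - 2n)` on the flag `G` and `q^(2n - d)` on the flag `H`. -/
structure Links (q : F) (d : ℕ) (G H : ℕ → Submodule F V) (X : Module.End F V) : Prop where
  start : Triangular G (weight q d) X
  target : Triangular H (fun n => (weight q d n)⁻¹) X

variable {q : F} {d : ℕ} {G H : ℕ → Submodule F V} {X Y : Module.End F V}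

theorem Links.symm (hq0 : q ≠ 0) (hG : IsFlag d G) (hH : IsFlag d H) (h : Links q d G H X)
    (hXY : Y * X = 1) : Links q d H G Y where
  start := by simpa using h.target.inverse hH (fun n => inv_ne_zero (weight_ne_zero hq0 d n)) hXY
  target := h.start.inverse hG (weight_ne_zero hq0 d) hXY

variable (hq0 : q ≠ 0) (hq : ∀ n : ℕ, 0 < n → q ^ n ≠ 1) (hG : IsFlag d G) (hH : IsFlag d H)
include hq0 hq hG hH

/-- By induction on `n`, a vector in the intersection has `X v` equal to `q^(d-2n)` times `v`; but
on `H m` the operator `X` has only the eigenvalues `q^(2i-d)` with `i < m`, and equality would need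
`i = d - n`. -/
theorem Links.disjoint (h : Links q d G H X) {n m : ℕ} (hnm : n + m ≤ d + 1) {v : V}
    (hvG : v ∈ G n) (hvH : v ∈ H m) : v = 0 := by
  induction n generalizing v with
  | zero => simpa [hG.zero] using hvG
  | succ n ih =>
    have h1 := ih (by omega) (h.start n v hvG)
      (Submodule.sub_mem _ (h.target.mapsTo hH hvH) (Submodule.smul_mem _ _ hvH))
    refine h.target.eq_zero_of_eigen hH (n := m) (μ := weight q d n) ?_ hvH (sub_eq_zero.1 h1)
    intro i hi he
    have := weight_eq_inv hq0 hq he.symm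
    omega

omit hH in
theorem Links.mem_start (h : Links q d G H X) {n : ℕ} (hn : n ≤ d) {v : V}
    (hv : X v = weight q d n • v) : v ∈ G (n + 1) :=
  h.start.eigenspace_le hG (fun _ _ hij _ he => hij.ne (weight_injective hq0 hq he)) hn hv

omit hG in
theorem Links.mem_stop (h : Links q d G H X) {n : ℕ} (hn : n ≤ d) {v : V}
    (hv : X v = weight q d n • v) : v ∈ H (d - n + 1) :=
  h.target.eigenspace_le hH
    (fun _ _ hij _ he => hij.ne (weight_injective hq0 hq (inv_injective he))) (Nat.sub_le _ _)
    (by rw [hv, weight_sub hn, inv_inv])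

omit hH in
theorem Links.ext (h : Links q d G H X) {Y Z : Module.End F V}
    (he : ∀ n ≤ d, ∀ v, X v = weight q d n • v → Y v = Z v) : Y = Z :=
  h.start.ext_on_eigenvectors hG (fun _ _ hij _ he => hij.ne (weight_injective hq0 hq he)) he

/-- A weight vector of `X` of index `n` lies in `G (n + 1)` and in `H (d - n + 1)`. On both
quotients `Y` acts by the same scalar, so the error lies in `G n ⊓ H (d - n)`, which is zero. -/
theorem Links.unique (hX : Links q d G H X) (hY : Links q d G H Y) : X = Y := by
  refine hX.ext hq0 hq hG fun n hn v hv => ?_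
  have h1 := hX.mem_start hq0 hq hG hn hv
  have h2 := hX.mem_stop hq0 hq hH hn hv
  have h3 := hY.target _ v h2
  simp only [weight_sub hn, inv_inv] at h3
  have := hX.disjoint hq0 hq hG hH (by omega) (hY.start n v h1) h3
  rw [hv, sub_eq_zero.1 this]

-- Meeting at starting points is equality of flags, and the decomposition is recovered from `X` as
-- its eigenspaces. This makes uniqueness and identification of edge maps a matter of triangularity
-- alone.
omit hG hH in
theorem isEdgeMap_iff {D : Vertex → ℕ → Submodule F V} {x y : Vertex}
    (hx : IsDecomposition d (D x)) (hy : IsDecomposition d (D y)) :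
    IsEdgeMap q d D x y X ↔ Links q d (partialSum (D x)) (partialSum (D y)) X := by
  constructor
  · rintro ⟨W, hW, h1, h2, h3⟩
    have transfer : ∀ {W W' : ℕ → Submodule F V}, IsDecomposition d W → IsDecomposition d W' →
        SameStart d W W' → partialSum W = partialSum W' := by
      intro W W' hW hW' he
      funext n
      rcases Nat.eq_zero_or_pos n with rfl | h0
      · rw [hW.isFlag.zero, hW'.isFlag.zero]
      rcases le_or_gt n d with hn | hn
      · have : partialSum W (n - 1 + 1) = partialSum W' (n - 1 + 1) := he (n - 1) (by omega)
        rwa [Nat.sub_add_cancel h0] at this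
      · rw [hW.isFlag.top n hn, hW'.isFlag.top n hn]
    rw [← transfer hW hx h1, ← transfer hW.inversion hy h2]
    refine ⟨hW.triangular h3, hW.inversion.triangular fun n hn v hv => ?_⟩
    rw [← weight_sub hn]
    exact h3 (d - n) (Nat.sub_le _ _) v hv
  · intro h
    have s1 := fun (n : ℕ) (hn : n ≤ d + 1) => h.start.eq_partialSum hx.isFlag
      (fun _ _ hij _ he => hij.ne (weight_injective hq0 hq he)) hn
    have s2 := fun (n : ℕ) (hn : n ≤ d + 1) => h.target.eq_partialSum hy.isFlag
      (fun _ _ hij _ he => hij.ne (weight_injective hq0 hq (inv_injective he))) hn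
    refine ⟨fun i => X.eigenspace (weight q d i), ⟨?_, ?_⟩, ?_, ?_, ?_⟩
    · intro i hi hbot
      apply hx.not_le hi
      rw [s1 (i + 1) (by omega), s1 i (by omega)]
      refine iSup₂_le fun j hj => ?_
      rcases Nat.lt_succ_iff_lt_or_eq.1 (Finset.mem_range.1 hj) with h1 | rfl
      · exact le_partialSum (fun i => X.eigenspace (weight q d i)) h1
      · rw [hbot]; exact bot_le
    · rw [DirectSum.isInternal_submodule_iff_iSupIndep_and_iSup_eq_top]
      constructor
      · refine (Module.End.eigenspaces_iSupIndep X).comp (f := fun i : Fin (d + 1) => weight q d i)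
          fun i j hij => Fin.ext (weight_injective hq0 hq hij)
      · rw [← partialSum_eq_iSup_fin (fun i => X.eigenspace (weight q d i)), ← s1 _ le_rfl,
          hx.isFlag.top _ d.lt_succ_self]
    · exact fun i hi => (s1 (i + 1) (by omega)).symm
    · intro i hi
      refine Eq.trans ?_ (s2 (i + 1) (by omega)).symm
      refine iSup_congr fun j => iSup_congr fun hj => ?_
      have := Finset.mem_range.1 hj
      simp only [inversion, weight_sub (show j ≤ d by omega)]
    · intro i _ w hw
      exact Module.End.mem_eigenspace_iff.1 hw

end Links

end OnsagerDiagram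

namespace OnsagerDiagram

/-! ### Opposite flags and split decompositions -/

section Split

variable {F V : Type*} [Field F] [AddCommGroup V] [Module F V]

/-- No proper nonzero subspace is stable under both `A` and `S`. -/
def IsIrreduciblePair (A S : Module.End F V) : Prop :=
  ∀ M : Submodule F V, (∀ v ∈ M, A v ∈ M) → (∀ v ∈ M, S v ∈ M) → M = ⊥ ∨ M = ⊤

/-- `S` is triangular on the flag `G`, `A` is triangular on the flag `H`, and each of them
raises the other flag by at most one step. -/
structure IsTridiagonal (δ d : ℕ) (G H : ℕ → Submodule F V) (l m : ℕ → F)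
    (A S : Module.End F V) : Prop where
  flagG : IsFlag δ G
  flagH : IsFlag d H
  triG : Triangular G l S
  triH : Triangular H m A
  raiseG : ∀ n, ∀ v ∈ G n, A v ∈ G (n + 1)
  raiseH : ∀ n, ∀ v ∈ H n, S v ∈ H (n + 1)

/-- The sum of the intersections `G n ∩ H m` with `n + m = s`. -/
def splitSum (G H : ℕ → Submodule F V) (s : ℕ) : Submodule F V :=
  ⨆ n, ⨆ m, ⨆ _ : n + m = s, G n ⊓ H m

theorem le_splitSum (G H : ℕ → Submodule F V) {n m s : ℕ} (h : n + m = s) :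
    G n ⊓ H m ≤ splitSum G H s :=
  le_iSup_of_le n (le_iSup_of_le m (le_iSup_of_le h le_rfl))

theorem splitSum_le {G H : ℕ → Submodule F V} {s : ℕ} {M : Submodule F V}
    (h : ∀ n m, n + m = s → G n ⊓ H m ≤ M) : splitSum G H s ≤ M :=
  iSup_le fun n => iSup_le fun m => iSup_le fun e => h n m e

theorem splitSum_comm (G H : ℕ → Submodule F V) (s : ℕ) : splitSum G H s = splitSum H G s := by
  apply le_antisymm <;> refine splitSum_le fun n m h => ?_ <;> rw [inf_comm] <;>
    exact le_splitSum _ _ (by omega)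

variable {δ d : ℕ} {G H : ℕ → Submodule F V} {l m : ℕ → F} {A S : Module.End F V}

namespace IsTridiagonal

theorem symm (h : IsTridiagonal δ d G H l m A S) : IsTridiagonal d δ H G m l S A :=
  ⟨h.flagH, h.flagG, h.triH, h.triG, h.raiseH, h.raiseG⟩

/-- `A - m k` raises the `G`-index by one and lowers the `H`-index by one, so `n + m` is preserved.
The symmetric statement handles `S`. -/
theorem splitSum_stable (h : IsTridiagonal δ d G H l m A S) {s : ℕ} {v : V}
    (hv : v ∈ splitSum G H s) : A v ∈ splitSum G H s := by
  have : splitSum G H s ≤ (splitSum G H s).comap A := by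
    refine splitSum_le fun n k hnk w hw => ?_
    cases k with
    | zero =>
      have : w = 0 := by simpa [h.flagH.zero] using hw.2
      simp [this]
    | succ k =>
      have h1 : A w - m k • w ∈ G (n + 1) ⊓ H k :=
        ⟨Submodule.sub_mem _ (h.raiseG n w hw.1)
          (Submodule.smul_mem _ _ (h.flagG.mono n.le_succ hw.1)), h.triH k w hw.2⟩
      have h2 := Submodule.add_mem _ (le_splitSum G H (s := s) (by omega) h1)
        (Submodule.smul_mem _ (m k) (le_splitSum G H hnk hw))
      simpa using h2
  exact this hv

theorem splitSum_eq_bot_or_top (h : IsTridiagonal δ d G H l m A S) (hirr : IsIrreduciblePair A S)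
    (s : ℕ) : splitSum G H s = ⊥ ∨ splitSum G H s = ⊤ :=
  hirr _ (fun _ hv => h.splitSum_stable hv) fun v hv => by
    rw [splitSum_comm] at hv ⊢
    exact h.symm.splitSum_stable hv

/-- Since `G 0 = 0`, only terms with second index at most `d` contribute, and these lie in the
proper subspace `H d`. -/
theorem splitSum_eq_bot (h : IsTridiagonal δ d G H l m A S) (hirr : IsIrreduciblePair A S)
    (hH : H d ≠ ⊤) {s : ℕ} (hs : s ≤ d + 1) : splitSum G H s = ⊥ := by
  refine (h.splitSum_eq_bot_or_top hirr s).resolve_right fun ht => hH (top_le_iff.1 ?_)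
  rw [← ht]
  refine splitSum_le fun n k hnk => ?_
  cases n with
  | zero => rw [h.flagG.zero, bot_inf_eq]; exact bot_le
  | succ n => exact inf_le_right.trans (h.flagH.mono (by omega))

theorem le_of_irreducible (h : IsTridiagonal δ d G H l m A S) (hirr : IsIrreduciblePair A S)
    (hH : H d ≠ ⊤) (hH1 : H 1 ≠ ⊥) : d ≤ δ := by
  by_contra hlt
  have h1 := h.splitSum_eq_bot hirr hH (s := δ + 1 + 1) (by omega)
  have h2 := le_splitSum G H (rfl : δ + 1 + 1 = δ + 1 + 1)
  rw [h1, h.flagG.top _ δ.lt_succ_self, top_inf_eq] at h2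
  exact hH1 (le_bot_iff.1 h2)

/-- Index sum `d + 1` gives zero, whence disjointness. Index sum `d + 2` contains `G 1`, hence gives
everything, and each of its terms lies in `G n` or in `H k`. -/
theorem isCompl (h : IsTridiagonal d d G H l m A S) (hirr : IsIrreduciblePair A S)
    (hH : H d ≠ ⊤) (hG1 : G 1 ≠ ⊥) {n k : ℕ} (hnk : n + k = d + 1) : IsCompl (G n) (H k) := by
  constructor
  · rw [disjoint_iff, ← le_bot_iff, ← h.splitSum_eq_bot hirr hH le_rfl]
    exact le_splitSum G H hnk
  · rw [codisjoint_iff, ← top_le_iff]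
    have ht : splitSum G H (d + 2) = ⊤ := by
      refine (h.splitSum_eq_bot_or_top hirr _).resolve_left fun hb => hG1 (le_bot_iff.1 ?_)
      have h2 := le_splitSum G H (show 1 + (d + 1) = d + 2 by omega)
      rwa [hb, h.flagH.top _ d.lt_succ_self, inf_top_eq] at h2
    rw [← ht]
    refine splitSum_le fun i j hij => ?_
    rcases le_or_gt i n with hi | hi
    · exact inf_le_left.trans ((h.flagG.mono hi).trans le_sup_left)
    · exact inf_le_right.trans ((h.flagH.mono (by omega)).trans le_sup_right)

theorem exists_links (q : F) (h : IsTridiagonal d d G H l m A S) (hirr : IsIrreduciblePair A S)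
    (hH : H d ≠ ⊤) (hG1 : G 1 ≠ ⊥) : ∃ K, Links q d G H K := by
  -- `p n` is the projection onto `G n` along `H (d + 1 - n)`; for `n > d + 1`, where `G n` is
  -- already everything, the identity serves.
  have hp : ∀ n, ∃ p : Module.End F V, (∀ v, p v ∈ G n) ∧ (∀ v ∈ G n, p v = v) ∧
      (∀ k, n + k = d + 1 → ∀ v ∈ H k, p v = 0) ∧
      (∀ k, n + k = d + 1 → ∀ v, v - p v ∈ H k) := by
    intro n
    rcases le_or_gt n (d + 1) with hn | hn
    · have hc := h.isCompl hirr hH hG1 (n := n) (k := d + 1 - n) (by omega)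
      refine ⟨(G n).projection _ hc, fun v => ?_, fun v hv => ?_, fun k hk v hv => ?_, fun k hk v => ?_⟩
      · exact Submodule.projection_apply_mem hc v
      · exact Submodule.projection_apply_of_mem_left hc hv
      · obtain rfl : k = d + 1 - n := by omega
        exact (Submodule.projection_apply_eq_zero_iff hc).2 hv
      · obtain rfl : k = d + 1 - n := by omega
        exact Submodule.sub_projection_mem hc v
    · refine ⟨1, fun v => ?_, fun v _ => rfl, fun k hk => by omega, fun k hk => by omega⟩
      rw [h.flagG.top n (by omega)]; trivial
  choose p hpG hpid hpH hpc using hp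
  have hpid' : ∀ {i n : ℕ}, n ≤ i → ∀ v ∈ G n, p i v = v := fun hni v hv =>
    hpid _ v (h.flagG.mono hni hv)
  have hpH' : ∀ {i k : ℕ}, i + k ≤ d + 1 → ∀ v ∈ H k, p i v = 0 := fun {i k} hik v hv =>
    hpH i (d + 1 - i) (by omega) v (h.flagH.mono (by omega) hv)
  -- `p (i + 1) - p i` projects onto the component `G (i + 1) ⊓ H (d + 1 - i)` of the split
  -- decomposition.
  refine ⟨∑ i ∈ Finset.range (d + 1), weight q d i • (p (i + 1) - p i), ?_, ?_⟩
  · intro n v hv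
    rcases le_or_gt n d with hn | hn
    swap
    · rw [h.flagG.top n hn]; trivial
    rw [LinearMap.sum_apply, ← Finset.sum_erase_add _ _ (Finset.mem_range.2 (show n < d + 1 by omega)),
      add_sub_assoc]
    refine Submodule.add_mem _ (Submodule.sum_mem _ fun i hi => ?_) ?_
    · rw [LinearMap.smul_apply, LinearMap.sub_apply]
      refine Submodule.smul_mem _ _ ?_
      rcases lt_or_gt_of_ne (Finset.ne_of_mem_erase hi) with h1 | h1
      · exact Submodule.sub_mem _ (h.flagG.mono (by omega) (hpG (i + 1) v))
          (h.flagG.mono (by omega) (hpG i v))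
      · rw [hpid' (show n + 1 ≤ i + 1 by omega) v hv, hpid' (show n + 1 ≤ i by omega) v hv, sub_self]
        exact Submodule.zero_mem _
    · rw [LinearMap.smul_apply, LinearMap.sub_apply, hpid _ v hv, ← smul_sub]
      refine Submodule.smul_mem _ _ ?_
      simpa using hpG n v
  · intro n v hv
    rcases le_or_gt n d with hn | hn
    swap
    · rw [h.flagH.top n hn]; trivial
    rw [LinearMap.sum_apply, ← Finset.sum_erase_add _ _
      (Finset.mem_range.2 (show d - n < d + 1 by omega)), add_sub_assoc]
    refine Submodule.add_mem _ (Submodule.sum_mem _ fun i hi => ?_) ?_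
    · rw [LinearMap.smul_apply, LinearMap.sub_apply]
      refine Submodule.smul_mem _ _ ?_
      have hid := Finset.mem_range.1 (Finset.mem_of_mem_erase hi)
      rcases lt_or_gt_of_ne (Finset.ne_of_mem_erase hi) with h1 | h1
      · rw [hpH' (show i + 1 + (n + 1) ≤ d + 1 by omega) v hv,
          hpH' (show i + (n + 1) ≤ d + 1 by omega) v hv, sub_self]
        exact Submodule.zero_mem _
      · have e : p (i + 1) v - p i v = (v - p i v) - (v - p (i + 1) v) := by abel
        rw [e]
        exact Submodule.sub_mem _
          (h.flagH.mono (show d + 1 - i ≤ n by omega) (hpc i _ (by omega) v))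
          (h.flagH.mono (show d + 1 - (i + 1) ≤ n by omega) (hpc (i + 1) _ (by omega) v))
    · rw [LinearMap.smul_apply, LinearMap.sub_apply,
        hpH' (show d - n + (n + 1) ≤ d + 1 by omega) v hv, sub_zero, weight_sub hn, ← smul_sub]
      refine Submodule.smul_mem _ _ ?_
      rw [← neg_sub]
      exact Submodule.neg_mem _ (hpc (d - n + 1) n (by omega) v)

/-- The `q`-Weyl type relation between the map of a split decomposition and `A`. -/
theorem links_relation {q a : F} (h : IsTridiagonal d d G H l m A S) {K : Module.End F V}
    (hK : Links q d G H K) (hq0 : q ≠ 0) (hq : ∀ n : ℕ, 0 < n → q ^ n ≠ 1) (ha : a ≠ 0)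
    (hm : ∀ n ≤ d, m n = a * (weight q d n)⁻¹ + a⁻¹ * weight q d n) :
    q • (K * A) - q⁻¹ • (A * K) = (q - q⁻¹) • (a • (K * K) + a⁻¹ • 1) := by
  refine hK.ext hq0 hq h.flagG fun n hn v hv => ?_
  have hG := hK.mem_start hq0 hq h.flagG hn hv
  have hH := hK.mem_stop hq0 hq h.flagH hn hv
  set r := A v - m (d - n) • v with hr
  have hrH : r ∈ H (d - n) := h.triH _ v hH
  have hrG : r ∈ G (n + 2) := Submodule.sub_mem _ (h.raiseG _ v hG)
    (Submodule.smul_mem _ _ (h.flagG.mono (Nat.le_succ _) hG))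
  -- Here `r` lies in `G (n + 2) ⊓ H (d - n)`. So `K r - q^(d-2(n+1)) r` lies in `G (n + 1) ⊓ H (d -
  -- n)`, which is zero: `A` shifts the weight index by one.
  have hKr : K r = weight q d (n + 1) • r := by
    rw [← sub_eq_zero]
    exact hK.disjoint hq0 hq h.flagG h.flagH (n := n + 1) (m := d - n) (by omega)
      (hK.start (n + 1) r hrG)
      (Submodule.sub_mem _ (hK.target.mapsTo h.flagH hrH) (Submodule.smul_mem _ _ hrH))
  have hAv : A v = r + m (d - n) • v := by rw [hr]; abel
  have hw := weight_ne_zero hq0 d n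
  have hm' : m (d - n) = a * weight q d n + a⁻¹ * (weight q d n)⁻¹ := by
    rw [hm _ (Nat.sub_le _ _), weight_sub hn, inv_inv]
  have hs : weight q d (n + 1) = (q ^ 2)⁻¹ * weight q d n := by
    rw [weight_succ hq0 d n, inv_mul_cancel_left₀ (pow_ne_zero 2 hq0)]
  simp only [LinearMap.sub_apply, LinearMap.add_apply, LinearMap.smul_apply, Module.End.mul_apply,
    Module.End.one_apply, hv, hAv, map_add, map_smul, hKr, hm', hs]
  match_scalars
  · field_simp
    ring
  · field_simp
    ring

end IsTridiagonal

end Split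

end OnsagerDiagram

namespace OnsagerDiagram

/-! ### The quadratic relation between two split maps -/

section Quadratic

variable {F V : Type*} [Field F] [AddCommGroup V] [Module F V]

/-- The smallest subspace containing `M` and stable under `X` and `Y`. -/
def stableHull (X Y : Module.End F V) (M : Submodule F V) : Submodule F V :=
  sInf {N | M ≤ N ∧ N ≤ N.comap X ∧ N ≤ N.comap Y}

section stableHull

variable {X Y : Module.End F V} {M N : Submodule F V}

theorem le_stableHull : M ≤ stableHull X Y M := le_sInf fun _ h => h.1

theorem stableHull_le (h : M ≤ N) (hX : N ≤ N.comap X) (hY : N ≤ N.comap Y) :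
    stableHull X Y M ≤ N := sInf_le ⟨h, hX, hY⟩

theorem stableHull_left : stableHull X Y M ≤ (stableHull X Y M).comap X := by
  intro v hv
  refine (Submodule.mem_sInf).2 fun N hN => hN.2.1 ?_
  exact (Submodule.mem_sInf).1 hv N hN

theorem stableHull_right : stableHull X Y M ≤ (stableHull X Y M).comap Y := by
  intro v hv
  refine (Submodule.mem_sInf).2 fun N hN => hN.2.2 ?_
  exact (Submodule.mem_sInf).1 hv N hN

/-- If `T X`, `T Y` are combinations of `X T`, `Y T` and polynomials in `X`, `Y`, and `T` maps the
range of `Q` into the stable hull of that range, then the stable hull is `T`-stable. -/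
theorem stableHull_range_stable {Q T : Module.End F V} {x x₀ x₁ y y₀ y₁ : F}
    (hX : T * X = x • (X * T) + x₀ • 1 + x₁ • (X * X))
    (hY : T * Y = y • (Y * T) + y₀ • 1 + y₁ • (Y * Y))
    (hQ : ∀ v, T (Q v) ∈ stableHull X Y (LinearMap.range Q)) :
    ∀ v ∈ stableHull X Y (LinearMap.range Q), T v ∈ stableHull X Y (LinearMap.range Q) := by
  set M := stableHull X Y (LinearMap.range Q) with hM
  -- By minimality of the hull it suffices that the vectors `v` with both `v` and `T v` in `M` form
  -- a subspace stable under `X` and `Y` and containing the range of `Q`.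
  have key : M ≤ M ⊓ M.comap T := by
    refine stableHull_le (le_inf le_stableHull ?_) ?_ ?_
    · rintro _ ⟨v, rfl⟩
      exact hQ v
    · rintro v ⟨hv, hTv⟩
      have hXv : X v ∈ M := stableHull_left hv
      refine ⟨hXv, ?_⟩
      have e : T (X v) = x • X (T v) + x₀ • v + x₁ • X (X v) := LinearMap.congr_fun hX v
      change T _ ∈ M
      rw [e]
      exact Submodule.add_mem _ (Submodule.add_mem _ (Submodule.smul_mem _ _ (stableHull_left hTv))
        (Submodule.smul_mem _ _ hv)) (Submodule.smul_mem _ _ (stableHull_left hXv))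
    · rintro v ⟨hv, hTv⟩
      have hYv : Y v ∈ M := stableHull_right hv
      refine ⟨hYv, ?_⟩
      have e : T (Y v) = y • Y (T v) + y₀ • v + y₁ • Y (Y v) := LinearMap.congr_fun hY v
      change T _ ∈ M
      rw [e]
      exact Submodule.add_mem _ (Submodule.add_mem _ (Submodule.smul_mem _ _ (stableHull_right hTv))
        (Submodule.smul_mem _ _ hv)) (Submodule.smul_mem _ _ (stableHull_right hYv))
  exact fun v hv => (key hv).2

end stableHull

/-- The quadratic expression in `X`, `Y` that vanishes for the two maps of the split
decompositions which share an end point. -/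
def splitQuadratic (q e : F) (X Y : Module.End F V) : Module.End F V :=
  (e - q) • (X * X) + (e - q⁻¹) • (Y * Y) + (q + q⁻¹ - e) • (Y * X) - e • (X * Y)

/-- The relation that each map of a split decomposition satisfies with `A`. -/
def LowerRelation (q a : F) (X A : Module.End F V) : Prop :=
  q • (X * A) - q⁻¹ • (A * X) = (q - q⁻¹) • (a • (X * X) + a⁻¹ • 1)

/-- The relation that each map of a split decomposition satisfies with `A*`. -/
def RaiseRelation (q b : F) (X S : Module.End F V) : Prop :=
  q • (S * X) - q⁻¹ • (X * S) = (q - q⁻¹) • (b • (X * X) + b⁻¹ • 1)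

variable {q a b : F} {X Y A S : Module.End F V}

theorem LowerRelation.mul_eq (hq0 : q ≠ 0) (h : LowerRelation q a X A) :
    A * X = q ^ 2 • (X * A) + (-(q ^ 2 - 1) * a⁻¹) • 1 + (-(q ^ 2 - 1) * a) • (X * X) := by
  have e : A * X = q • (q • (X * A) - (q • (X * A) - q⁻¹ • (A * X))) := by
    match_scalars <;> field_simp
    ring
  rw [e, h]
  match_scalars <;> field_simp

theorem RaiseRelation.mul_eq (hq0 : q ≠ 0) (h : RaiseRelation q b X S) :
    S * X = (q⁻¹) ^ 2 • (X * S) + ((1 - (q⁻¹) ^ 2) * b⁻¹) • 1 +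
      ((1 - (q⁻¹) ^ 2) * b) • (X * X) := by
  have e : S * X = q⁻¹ • (q⁻¹ • (X * S) + (q • (S * X) - q⁻¹ • (X * S))) := by
    match_scalars <;> field_simp
    ring
  rw [e, h]
  match_scalars <;> field_simp

/-- Coefficients are left general so that one expansion serves both `A` and `S`. The linear terms in
`X` and `Y` are the obstruction to writing the result through the quadratic expression. -/
theorem quad_mul_eq {x x₀ x₁ y₀ y₁ : F} {T : Module.End F V}
    (hX : T * X = x • (X * T) + x₀ • 1 + x₁ • (X * X))
    (hY : T * Y = x • (Y * T) + y₀ • 1 + y₁ • (Y * Y)) (f g r s : F) :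
    T * (f • (X * X) + g • (Y * Y) + r • (Y * X) - s • (X * Y)) =
      x ^ 2 • ((f • (X * X) + g • (Y * Y) + r • (Y * X) - s • (X * Y)) * T) +
      (f * (x + 1) * x₀ + r * y₀ - s * x * y₀) • X +
      (g * (x + 1) * y₀ + r * x * x₀ - s * x₀) • Y +
      (f * (x + 1) * x₁) • (X * X * X) + (g * (x + 1) * y₁) • (Y * Y * Y) +
      (r * y₁) • (Y * Y * X) + (r * x * x₁) • (Y * X * X) - (s * x₁) • (X * X * Y) -
      (s * x * y₁) • (X * Y * Y) := by
  have hXX : T * (X * X) = x ^ 2 • (X * X * T) + ((x + 1) * x₀) • X +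
      ((x + 1) * x₁) • (X * X * X) := by
    rw [← mul_assoc, hX]
    simp only [add_mul, smul_mul_assoc, one_mul, mul_assoc, hX, mul_add, mul_smul_comm, mul_one]
    module
  have hYY : T * (Y * Y) = x ^ 2 • (Y * Y * T) + ((x + 1) * y₀) • Y +
      ((x + 1) * y₁) • (Y * Y * Y) := by
    rw [← mul_assoc, hY]
    simp only [add_mul, smul_mul_assoc, one_mul, mul_assoc, hY, mul_add, mul_smul_comm, mul_one]
    module
  have hYX : T * (Y * X) = x ^ 2 • (Y * X * T) + (x * x₀) • Y + y₀ • X +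
      y₁ • (Y * Y * X) + (x * x₁) • (Y * X * X) := by
    rw [← mul_assoc, hY]
    simp only [add_mul, smul_mul_assoc, one_mul, mul_assoc, hX, mul_add, mul_smul_comm, mul_one]
    module
  have hXY : T * (X * Y) = x ^ 2 • (X * Y * T) + (x * y₀) • X + x₀ • Y +
      x₁ • (X * X * Y) + (x * y₁) • (X * Y * Y) := by
    rw [← mul_assoc, hX]
    simp only [add_mul, smul_mul_assoc, one_mul, mul_assoc, hY, mul_add, mul_smul_comm, mul_one]
    module
  simp only [mul_add, mul_sub, add_mul, sub_mul, mul_smul_comm, smul_mul_assoc, hXX, hYY, hYX, hXY]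
  module

/-- The linear terms of `quad_mul_eq` cancel for this value of `e`: both coefficients reduce to the
condition `e (1 - a²) = q - q⁻¹ a²`. The cubic terms regroup as products with the quadratic
expression. -/
theorem LowerRelation.mul_splitQuadratic (hq0 : q ≠ 0) (ha : a ≠ 0) (ha2 : 1 - a ^ 2 ≠ 0)
    (hX : LowerRelation q a X A) (hY : LowerRelation q a⁻¹ Y A) {e : F}
    (he : e = (q - q⁻¹ * a ^ 2) / (1 - a ^ 2)) :
    A * splitQuadratic q e X Y = (q ^ 2) ^ 2 • (splitQuadratic q e X Y * A) +
      (-(q - q⁻¹) * (a * q ^ 2 * e)) • (X * splitQuadratic q e X Y) +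
      (-(q - q⁻¹) * (a * q ^ 2 * (q + q⁻¹ - e))) • (splitQuadratic q e X Y * X) +
      (-(q - q⁻¹) * (a⁻¹ * q ^ 2 * (q + q⁻¹ - e))) • (Y * splitQuadratic q e X Y) +
      (-(q - q⁻¹) * (a⁻¹ * q ^ 2 * e)) • (splitQuadratic q e X Y * Y) := by
  have h := quad_mul_eq (hX.mul_eq hq0) (hY.mul_eq hq0) (e - q) (e - q⁻¹) (q + q⁻¹ - e) e
  rw [splitQuadratic, h]
  -- The product with `A` on the right is common to both sides; made opaque, it leaves an identity
  -- between words in `X` and `Y`.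
  generalize (_ : Module.End F V) * A = Z
  simp only [mul_add, mul_sub, add_mul, sub_mul, mul_smul_comm, smul_mul_assoc, mul_assoc]
  rw [he]
  match_scalars <;> field_simp <;> ring

/-- Here `X` and `Y` carry the same parameter `b`, and the linear terms cancel for every `e`. -/
theorem RaiseRelation.mul_splitQuadratic (hq0 : q ≠ 0) (hb : b ≠ 0)
    (hX : RaiseRelation q b X S) (hY : RaiseRelation q b Y S) {e : F} :
    S * splitQuadratic q e X Y = (q⁻¹ ^ 2) ^ 2 • (splitQuadratic q e X Y * S) +
      ((q - q⁻¹) * (b * q⁻¹ ^ 2 * e)) • (X * splitQuadratic q e X Y) +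
      ((q - q⁻¹) * (b * q⁻¹ ^ 2 * (q + q⁻¹ - e))) • (splitQuadratic q e X Y * X) +
      ((q - q⁻¹) * (b * q⁻¹ ^ 2 * (q + q⁻¹ - e))) • (Y * splitQuadratic q e X Y) +
      ((q - q⁻¹) * (b * q⁻¹ ^ 2 * e)) • (splitQuadratic q e X Y * Y) := by
  have h := quad_mul_eq (hX.mul_eq hq0) (hY.mul_eq hq0) (e - q) (e - q⁻¹) (q + q⁻¹ - e) e
  rw [splitQuadratic, h]
  generalize (_ : Module.End F V) * S = Z
  simp only [mul_add, mul_sub, add_mul, sub_mul, mul_smul_comm, smul_mul_assoc, mul_assoc]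
  match_scalars <;> field_simp <;> ring

/-- The quadratic relation for two maps `X`, `Y` that act on the quotients of a common flag by the
same scalars. -/
theorem splitQuadratic_eq_zero (hirr : IsIrreduciblePair A S) (hq0 : q ≠ 0) (ha : a ≠ 0)
    (ha2 : 1 - a ^ 2 ≠ 0) (hb : b ≠ 0)
    (hXA : LowerRelation q a X A) (hYA : LowerRelation q a⁻¹ Y A)
    (hXS : RaiseRelation q b X S) (hYS : RaiseRelation q b Y S)
    {d : ℕ} {G : ℕ → Submodule F V} {l : ℕ → F} (hG : IsFlag d G) (hGd : G d ≠ ⊤)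
    (hX : Triangular G l X) (hY : Triangular G l Y) :
    splitQuadratic q ((q - q⁻¹ * a ^ 2) / (1 - a ^ 2)) X Y = 0 := by
  set e := (q - q⁻¹ * a ^ 2) / (1 - a ^ 2) with he
  set Q := splitQuadratic q e X Y with hQ
  set M := stableHull X Y (LinearMap.range Q) with hM
  have hQM : ∀ v, Q v ∈ M := fun v => le_stableHull ⟨v, rfl⟩
  have hXM : ∀ {v}, v ∈ M → X v ∈ M := fun hv => stableHull_left hv
  have hYM : ∀ {v}, v ∈ M → Y v ∈ M := fun hv => stableHull_right hv
  have combo : ∀ {T : Module.End F V} {x y z w u : F}, T * Q = x • (Q * T) + y • (X * Q) +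
      z • (Q * X) + w • (Y * Q) + u • (Q * Y) → ∀ v, T (Q v) ∈ M := by
    intro T x y z w u h v
    have h' : T (Q v) = x • Q (T v) + y • X (Q v) + z • Q (X v) + w • Y (Q v) + u • Q (Y v) :=
      LinearMap.congr_fun h v
    rw [h']
    exact M.add_mem (M.add_mem (M.add_mem (M.add_mem (M.smul_mem _ (hQM _))
      (M.smul_mem _ (hXM (hQM _)))) (M.smul_mem _ (hQM _))) (M.smul_mem _ (hYM (hQM _))))
      (M.smul_mem _ (hQM _))
  have hA := stableHull_range_stable (hXA.mul_eq hq0) (hYA.mul_eq hq0)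
    (combo (LowerRelation.mul_splitQuadratic hq0 ha ha2 hXA hYA he))
  have hS := stableHull_range_stable (hXS.mul_eq hq0) (hYS.mul_eq hq0)
    (combo (RaiseRelation.mul_splitQuadratic hq0 hb hXS hYS))
  -- `X` and `Y` both act on `V / G d` as the scalar `l d`, and the four coefficients of the
  -- quadratic expression sum to zero.
  have hMd : M ≤ G d := by
    refine stableHull_le ?_ (fun v hv => hX.mapsTo hG hv) (fun v hv => hY.mapsTo hG hv)
    rintro _ ⟨v, rfl⟩
    have hv : v ∈ G (d + 1) := by rw [hG.top _ d.lt_succ_self]; trivial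
    have key : ∀ {T T' : Module.End F V}, Triangular G l T → Triangular G l T' →
        T (T' v) - (l d * l d) • v ∈ G d := by
      intro T T' hT hT'
      have e1 : T (T' v) - (l d * l d) • v = T (T' v - l d • v) + l d • (T v - l d • v) := by
        rw [map_sub, map_smul]; module
      rw [e1]
      exact Submodule.add_mem _ (hT.mapsTo hG (hT' d v hv)) (Submodule.smul_mem _ _ (hT d v hv))
    have e2 : Q v = (e - q) • (X (X v) - (l d * l d) • v) +
        (e - q⁻¹) • (Y (Y v) - (l d * l d) • v) +
        (q + q⁻¹ - e) • (Y (X v) - (l d * l d) • v) - e • (X (Y v) - (l d * l d) • v) := by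
      simp only [hQ, splitQuadratic, LinearMap.sub_apply, LinearMap.add_apply,
        LinearMap.smul_apply, Module.End.mul_apply]
      module
    rw [e2]
    exact Submodule.sub_mem _ (Submodule.add_mem _ (Submodule.add_mem _
      (Submodule.smul_mem _ _ (key hX hX)) (Submodule.smul_mem _ _ (key hY hY)))
      (Submodule.smul_mem _ _ (key hY hX))) (Submodule.smul_mem _ _ (key hX hY))
  have hM0 : M = ⊥ := (hirr M hA hS).resolve_right fun ht => hGd (top_le_iff.1 (ht ▸ hMd))
  ext v
  have := hQM v
  rw [hM0, Submodule.mem_bot] at this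
  simpa using this

end Quadratic

end OnsagerDiagram

namespace OnsagerDiagram

/-! ### Inverses, shifts and conjugation by Ψ -/

section Triangle

variable {F V : Type*} [Field F] [AddCommGroup V] [Module F V]
variable {q a b : F} {d : ℕ} {G H H' : ℕ → Submodule F V} {A S K B X Y N Ψ : Module.End F V}

theorem LowerRelation.eigen_step (hq0 : q ≠ 0) (ha : a ≠ 0) (h : LowerRelation q a K A) {k : F}
    (hk : k ≠ 0) {v : V} (hv : K v = k • v) :
    K (A v - (a * k + a⁻¹ * k⁻¹) • v) = ((q ^ 2)⁻¹ * k) • (A v - (a * k + a⁻¹ * k⁻¹) • v) := by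
  have h1 := LinearMap.congr_fun (h.mul_eq hq0) v
  simp only [LinearMap.add_apply, LinearMap.smul_apply, Module.End.mul_apply,
    Module.End.one_apply, hv, map_smul] at h1
  have h2 : K (A v) = (q ^ 2)⁻¹ • (k • A v - (-(q ^ 2 - 1) * a⁻¹) • v -
      (-(q ^ 2 - 1) * a) • k • k • v) := by
    rw [h1, eq_inv_smul_iff₀ (pow_ne_zero 2 hq0)]
    abel
  rw [map_sub, map_smul, h2, hv]
  match_scalars <;> field_simp
  ring

/-- Multiplying the relation by `K⁻¹` on both sides exchanges the two products and inverts both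
parameters. -/
theorem LowerRelation.inverse (hXK : X * K = 1) (hKX : K * X = 1) (h : LowerRelation q a K A) :
    LowerRelation q⁻¹ a⁻¹ X A := by
  have h1 : X * (q • (K * A) - q⁻¹ • (A * K)) * X = q • (A * X) - q⁻¹ • (X * A) := by
    simp only [mul_sub, sub_mul, mul_smul_comm, smul_mul_assoc]
    rw [← mul_assoc X K A, hXK, one_mul, mul_assoc X (A * K) X, mul_assoc A K X, hKX, mul_one]
  have h2 : X * ((q - q⁻¹) • (a • (K * K) + a⁻¹ • 1)) * X =
      (q - q⁻¹) • (a • 1 + a⁻¹ • (X * X)) := by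
    simp only [mul_add, add_mul, mul_smul_comm, smul_mul_assoc, mul_one]
    rw [← mul_assoc X K K, hXK, one_mul, hKX]
  rw [LowerRelation] at h
  rw [h, h2] at h1
  rw [LowerRelation, inv_inv, inv_inv]
  have h3 : q⁻¹ • (X * A) - q • (A * X) = -(q • (A * X) - q⁻¹ • (X * A)) := by abel
  rw [h3, ← h1]
  module

theorem raiseRelation_of_inverse (hXK : X * K = 1) (hKX : K * X = 1)
    (h : LowerRelation q b⁻¹ X S) : RaiseRelation q b K S := by
  have h1 := h.inverse hKX hXK
  rw [LowerRelation, inv_inv, inv_inv] at h1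
  rw [RaiseRelation]
  have h3 : q • (S * K) - q⁻¹ • (K * S) = -(q⁻¹ • (K * S) - q • (S * K)) := by abel
  rw [h3, h1]
  module

theorem raiseRelation_inverse (h : LowerRelation q b⁻¹ X S) : RaiseRelation q⁻¹ b⁻¹ X S := by
  rw [LowerRelation] at h
  rw [RaiseRelation, inv_inv, inv_inv]
  rw [inv_inv] at h
  have h3 : q⁻¹ • (S * X) - q • (X * S) = -(q • (X * S) - q⁻¹ • (S * X)) := by abel
  rw [h3, h]
  module

theorem LowerRelation.weyl (ha : a ≠ 0) (hXK : X * K = 1) (hKX : K * X = 1)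
    (h : LowerRelation q a K A) :
    q • ((a⁻¹ • A - (a ^ 2)⁻¹ • X) * X) - q⁻¹ • (X * (a⁻¹ • A - (a ^ 2)⁻¹ • X)) =
      (q - q⁻¹) • 1 := by
  have h1 := h.inverse hXK hKX
  rw [LowerRelation, inv_inv, inv_inv] at h1
  have e : q • ((a⁻¹ • A - (a ^ 2)⁻¹ • X) * X) - q⁻¹ • (X * (a⁻¹ • A - (a ^ 2)⁻¹ • X)) =
      -(a⁻¹ • (q⁻¹ • (X * A) - q • (A * X))) - ((q - q⁻¹) * (a ^ 2)⁻¹) • (X * X) := by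
    simp only [sub_mul, mul_sub, smul_mul_assoc, mul_smul_comm]
    module
  rw [e, h1]
  match_scalars <;> field_simp <;> ring

/-- With `Y` the shifted map, `A = a Y + a⁻¹ K⁻¹`; substituting this, the term in `Y K⁻¹` and `K⁻¹
Y` is evaluated by `LowerRelation.weyl`. -/
theorem LowerRelation.shift (ha : a ≠ 0) (hXK : X * K = 1) (hKX : K * X = 1)
    (h : LowerRelation q a K A) : LowerRelation q a (a⁻¹ • A - (a ^ 2)⁻¹ • X) A := by
  have h1 := h.weyl ha hXK hKX
  set Y := a⁻¹ • A - (a ^ 2)⁻¹ • X with hY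
  have hA : A = a • Y + a⁻¹ • X := by
    rw [hY]; match_scalars <;> field_simp
    ring
  rw [LowerRelation]
  have e : q • (Y * A) - q⁻¹ • (A * Y) =
      ((q - q⁻¹) * a) • (Y * Y) + a⁻¹ • (q • (Y * X) - q⁻¹ • (X * Y)) := by
    rw [hA]
    simp only [add_mul, mul_add, smul_mul_assoc, mul_smul_comm]
    module
  rw [e, h1]
  module

theorem Triangular.shift {k m : ℕ → F} (hH : IsFlag d H) (hA : Triangular H m A)
    (hK : Triangular H k K) (hXK : X * K = 1) (hk : ∀ n, k n ≠ 0)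
    (hm : ∀ n ≤ d, m n = a * k n + a⁻¹ * (k n)⁻¹) (ha : a ≠ 0) :
    Triangular H k (a⁻¹ • A - (a ^ 2)⁻¹ • X) := by
  refine ((hA.smul a⁻¹).sub ((hK.inverse hH hk hXK).smul (a ^ 2)⁻¹)).congr hH fun n hn => ?_
  rw [hm n hn]
  have := hk n
  field_simp
  ring

/-- If `Ψ` commutes with `A` and has suitable eigenvalues, then conjugation by `Ψ` sends `K` to
`a⁻¹ A - a⁻² K⁻¹`. -/
theorem conj_eq_shift {k m t : ℕ → F} (hq0 : q ≠ 0) (ha : a ≠ 0) (hH : IsFlag d H)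
    (hA : Triangular H m A) (hK : Triangular H k K) (hΨ : Triangular H t Ψ)
    (hcomm : Ψ * A = A * Ψ) (hrel : LowerRelation q a K A) (hXK : X * K = 1) (hKX : K * X = 1)
    (hk : ∀ n, k n ≠ 0) (hkinj : ∀ i j, i < j → k i ≠ k j) (hkq : ∀ n, k (n + 1) = q ^ 2 * k n)
    (hm : ∀ n ≤ d, m n = a * k n + a⁻¹ * (k n)⁻¹)
    (hminj : ∀ i j, i < j → j ≤ d → m i ≠ m j)
    (ht : ∀ n < d, t (n + 1) = a ^ 2 * k n * k (n + 1) * t n) :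
    Ψ * K = (a⁻¹ • A - (a ^ 2)⁻¹ • X) * Ψ := by
  have hYrel := hrel.shift ha hXK hKX
  have hYt := Triangular.shift hH hA hK hXK hk hm ha
  have hYv : ∀ v, (a⁻¹ • A - (a ^ 2)⁻¹ • X) v = a⁻¹ • A v - (a ^ 2)⁻¹ • X v := fun _ => rfl
  set Y := a⁻¹ • A - (a ^ 2)⁻¹ • X with hY
  have hc : ∀ v, Ψ (A v) = A (Ψ v) := LinearMap.congr_fun hcomm
  -- Induction along `H`: `Ψ` carries eigenvectors of `K` to eigenvectors of the shifted map `Y`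
  -- with the same eigenvalue.
  have key : ∀ n ≤ d, ∀ v ∈ H (n + 1), K v = k n • v → Y (Ψ v) = k n • Ψ v := by
    intro n
    induction n with
    | zero =>
      intro _ v hv _
      have h1 := hYt 0 (Ψ v) (hΨ.mapsTo hH hv)
      rw [hH.zero, Submodule.mem_bot] at h1
      exact sub_eq_zero.1 h1
    | succ n ih =>
      intro hn v hv hKv
      have hkn := hk n
      have hkn1 := hk (n + 1)
      set r := A v - m (n + 1) • v with hr
      have hAv : A v = r + m (n + 1) • v := by rw [hr]; abel
      have hrH : r ∈ H (n + 1) := hA _ v hv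
      have hkk : (q ^ 2)⁻¹ * k (n + 1) = k n := by
        rw [hkq, inv_mul_cancel_left₀ (pow_ne_zero 2 hq0)]
      have hKr : K r = k n • r := by
        have := hrel.eigen_step hq0 ha hkn1 hKv
        rwa [← hm _ hn, hkk] at this
      have hYΨr := ih (by omega) r hrH hKr
      -- `w` is the candidate for `Ψ v`: the eigenvector of `Y` with the right leading term `t (n +
      -- 1) v`.
      obtain ⟨w, hYw, hu⟩ := hYt.exists_eigenvector hH (n := n + 1) (fun i hi => hkinj i _ hi)
        (Submodule.smul_mem _ (t (n + 1)) hv)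
      set u := w - t (n + 1) • v with hu'
      have hw : w = u + t (n + 1) • v := by rw [hu']; abel
      set x := A w - m (n + 1) • w with hx
      have hYx : Y x = k n • x := by
        have := hYrel.eigen_step hq0 ha hkn1 hYw
        rwa [← hm _ hn, hkk] at this
      have hXv : X v = (k (n + 1))⁻¹ • v := by
        have : X (K v) = v := by rw [← Module.End.mul_apply, hXK, Module.End.one_apply]
        rw [hKv, map_smul] at this
        rw [eq_inv_smul_iff₀ hkn1, this]
      have hYv' : Y v = k (n + 1) • v + a⁻¹ • r := by
        rw [hYv, hAv, hXv, hm _ hn]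
        match_scalars <;> field_simp
        ring
      have hYu : Y u = k (n + 1) • u - (t (n + 1) * a⁻¹) • r := by
        rw [hu', map_sub, map_smul, hYw, hYv']
        module
      have hx' : x = t (n + 1) • r + A u - m (n + 1) • u := by
        rw [hx, hw, map_add, map_smul, hAv]
        module
      have h1 := hYt n u hu
      have h2 := hA n u hu
      -- Modulo `H n` the images of `u` under `Y` and `A` are both known multiples of `u`.
      -- Eliminating `u` leaves a multiple of `r`, and the recursion for `t` says that it is `t n`.
      have hxr : x - t n • r ∈ H n := by
        rw [← Submodule.smul_mem_iff _ (sub_ne_zero.2 (hkinj n (n + 1) n.lt_succ_self))]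
        have e : (k n - k (n + 1)) • (x - t n • r) = (k n - k (n + 1)) • (A u - m n • u) -
            (m n - m (n + 1)) • (Y u - k n • u) := by
          rw [hx', hYu, hm _ hn, hm n (by omega), ht n (by omega)]
          match_scalars <;> field_simp <;> ring
        rw [e]
        exact Submodule.sub_mem _ (Submodule.smul_mem _ _ h2) (Submodule.smul_mem _ _ h1)
      -- Both vectors satisfy the eigenvector equation of `Y` for `k n` and they agree modulo `H n`,
      -- where `k n` does not occur as an eigenvalue.
      have hxΨ : x - Ψ r = 0 := by
        refine hYt.eq_zero_of_eigen hH (n := n) (μ := k n) (fun i hi => hkinj i n hi) ?_ ?_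
        · have e : x - Ψ r = x - t n • r - (Ψ r - t n • r) := by abel
          rw [e]
          exact Submodule.sub_mem _ hxr (hΨ n r hrH)
        · rw [map_sub, hYx, hYΨr]
          exact (smul_sub _ _ _).symm
      -- Because `x = Ψ r`, the difference satisfies the eigenvector equation of `A` for `m (n +
      -- 1)`; it lies in `H (n + 1)`, where that eigenvalue does not occur.
      have hwΨ : w - Ψ v = 0 := by
        refine hA.eq_zero_of_eigen hH (n := n + 1) (μ := m (n + 1))
          (fun i hi => hminj i _ hi hn) ?_ ?_
        · have e : w - Ψ v = u - (Ψ v - t (n + 1) • v) := by rw [hu']; abel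
          rw [e]
          exact Submodule.sub_mem _ hu (hΨ _ v hv)
        · rw [← sub_eq_zero, map_sub, ← hc, hAv, map_add, map_smul]
          rw [← hxΨ, hx]
          module
      rw [← sub_eq_zero.1 hwΨ, hYw]
  refine hK.ext_on_eigenvectors hH (fun i j hij _ => hkinj i j hij) fun n hn v hv => ?_
  rw [Module.End.mul_apply, Module.End.mul_apply, hv, map_smul]
  exact (key n hn v (hK.eigenspace_le hH (fun i j hij _ => hkinj i j hij) hn hv) hv).symm

/-- The difference of the two sides is a scalar multiple of the quadratic expression; multiplying by
`N⁻¹` on both sides then produces a q-Weyl relation for `N⁻¹`. -/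
theorem weyl_of_splitQuadratic (ha : a ≠ 0) (ha2 : 1 - a ^ 2 ≠ 0)
    (h : splitQuadratic q ((q - q⁻¹ * a ^ 2) / (1 - a ^ 2)) X Y = 0)
    (hN : N = (a⁻¹ - a)⁻¹ • (a⁻¹ • Y - a • X)) :
    q • (X * N) - q⁻¹ • (N * X) = (q - q⁻¹) • (N * N) := by
  have hN' : N = (1 - a ^ 2)⁻¹ • (Y - a ^ 2 • X) := by
    rw [hN]
    have : a⁻¹ - a = a⁻¹ * (1 - a ^ 2) := by field_simp
    rw [this]
    match_scalars <;> field_simp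
  have e : q • (X * N) - q⁻¹ • (N * X) - (q - q⁻¹) • (N * N) =
      (-(1 - a ^ 2)⁻¹) • splitQuadratic q ((q - q⁻¹ * a ^ 2) / (1 - a ^ 2)) X Y := by
    rw [hN', splitQuadratic]
    simp only [sub_mul, mul_sub, smul_mul_assoc, mul_smul_comm, smul_sub]
    match_scalars <;> field_simp <;> ring
  rw [← sub_eq_zero, e, h, smul_zero]

theorem qWeyl_of_mul_inverse (hc : q - q⁻¹ ≠ 0) {M : Module.End F V} (hMN : M * N = 1)
    (hNM : N * M = 1) (h : q • (X * N) - q⁻¹ • (N * X) = (q - q⁻¹) • (N * N)) :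
    QWeyl q M X := by
  rw [QWeyl, inv_smul_eq_iff₀ hc]
  have h1 : M * (q • (X * N) - q⁻¹ • (N * X)) * M = q • (M * X) - q⁻¹ • (X * M) := by
    simp only [mul_sub, sub_mul, mul_smul_comm, smul_mul_assoc]
    rw [mul_assoc M (X * N) M, mul_assoc X N M, hNM, mul_one, ← mul_assoc M N X, hMN, one_mul]
  have h2 : M * ((q - q⁻¹) • (N * N)) * M = (q - q⁻¹) • 1 := by
    simp only [mul_smul_comm, smul_mul_assoc]
    rw [← mul_assoc M N N, hMN, one_mul, hNM]
  rw [← h1, h, h2]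

theorem qWeyl_inverse_of_mul (hc : q - q⁻¹ ≠ 0) {M : Module.End F V} (hMN : M * N = 1)
    (hNM : N * M = 1) (h : q • (N * X) - q⁻¹ • (X * N) = (q - q⁻¹) • (N * N)) :
    QWeyl q X M := by
  rw [QWeyl, inv_smul_eq_iff₀ hc]
  have h1 : M * (q • (N * X) - q⁻¹ • (X * N)) * M = q • (X * M) - q⁻¹ • (M * X) := by
    simp only [mul_sub, sub_mul, mul_smul_comm, smul_mul_assoc]
    rw [mul_assoc M (X * N) M, mul_assoc X N M, hNM, mul_one, ← mul_assoc M N X, hMN, one_mul]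
  have h2 : M * ((q - q⁻¹) • (N * N)) * M = (q - q⁻¹) • 1 := by
    simp only [mul_smul_comm, smul_mul_assoc]
    rw [← mul_assoc M N N, hMN, one_mul, hNM]
  rw [← h1, h, h2]

end Triangle

end OnsagerDiagram

namespace OnsagerDiagram

/-! ### One triangle of the diagram -/

section SplitConfig

variable {F V : Type*} [Field F] [AddCommGroup V] [Module F V]

/-- A flag `G` of `S` and two flags `H`, `H'` of `A`, together with the map `Ψ` that realizes the
Lusztig automorphism. -/
structure SplitConfig (q a b : F) (d : ℕ) (G H H' : ℕ → Submodule F V) (A S Ψ : Module.End F V)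
    (t t' : ℕ → F) : Prop where
  q_ne : q ≠ 0
  q_pow : ∀ n : ℕ, 0 < n → q ^ n ≠ 1
  a_ne : a ≠ 0
  a_sub : a - a⁻¹ ≠ 0
  b_ne : b ≠ 0
  irr : IsIrreduciblePair A S
  G_one : G 1 ≠ ⊥
  G_top : G d ≠ ⊤
  H_top : H d ≠ ⊤
  H_top' : H' d ≠ ⊤
  tri : IsTridiagonal d d G H (fun n => b * weight q d n + b⁻¹ * (weight q d n)⁻¹)
    (fun n => a * (weight q d n)⁻¹ + a⁻¹ * weight q d n) A S
  tri' : IsTridiagonal d d G H' (fun n => b * weight q d n + b⁻¹ * (weight q d n)⁻¹)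
    (fun n => a⁻¹ * (weight q d n)⁻¹ + a * weight q d n) A S
  inj : ∀ i j, i < j → j ≤ d → a * (weight q d i)⁻¹ + a⁻¹ * weight q d i ≠
    a * (weight q d j)⁻¹ + a⁻¹ * weight q d j
  inj' : ∀ i j, i < j → j ≤ d → a⁻¹ * (weight q d i)⁻¹ + a * weight q d i ≠
    a⁻¹ * (weight q d j)⁻¹ + a * weight q d j
  unit : IsUnit Ψ
  comm : Ψ * A = A * Ψ
  trit : Triangular H t Ψ
  trit' : Triangular H' t' Ψ
  t_succ : ∀ n < d, t (n + 1) = a ^ 2 * (weight q d n)⁻¹ * (weight q d (n + 1))⁻¹ * t n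
  t_succ' : ∀ n < d, t' (n + 1) = (a ^ 2)⁻¹ * (weight q d n)⁻¹ * (weight q d (n + 1))⁻¹ * t' n

variable {q a b : F} {d : ℕ} {G H H' : ℕ → Submodule F V} {A S Ψ : Module.End F V} {t t' : ℕ → F}

namespace SplitConfig

/-- Reading A from its other end replaces `a` by `a⁻¹`, so every statement about `K` yields one
about `B`. -/
theorem swap (h : SplitConfig q a b d G H H' A S Ψ t t') :
    SplitConfig q a⁻¹ b d G H' H A S Ψ t' t where
  q_ne := h.q_ne
  q_pow := h.q_pow
  a_ne := inv_ne_zero h.a_ne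
  a_sub := by rw [inv_inv, ← neg_sub]; exact neg_ne_zero.2 h.a_sub
  b_ne := h.b_ne
  irr := h.irr
  G_one := h.G_one
  G_top := h.G_top
  H_top := h.H_top'
  H_top' := h.H_top
  tri := by rw [inv_inv]; exact h.tri'
  tri' := by rw [inv_inv]; exact h.tri
  inj := by rw [inv_inv]; exact h.inj'
  inj' := by rw [inv_inv]; exact h.inj
  unit := h.unit
  comm := h.comm
  trit := h.trit'
  trit' := h.trit
  t_succ := by rw [inv_pow]; exact h.t_succ'
  t_succ' := by rw [inv_pow, inv_inv]; exact h.t_succ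

variable {K B : Module.End F V}

theorem exists_links (h : SplitConfig q a b d G H H' A S Ψ t t') : ∃ K, Links q d G H K :=
  h.tri.exists_links q h.irr h.H_top h.G_one

theorem q_sub_ne (h : SplitConfig q a b d G H H' A S Ψ t t') : q - q⁻¹ ≠ 0 := by
  intro he
  have hq := h.q_ne
  apply h.q_pow 2 (by norm_num)
  field_simp at he
  linear_combination he

theorem one_sub_ne (h : SplitConfig q a b d G H H' A S Ψ t t') : 1 - a ^ 2 ≠ 0 := by
  intro he
  have ha := h.a_ne
  apply h.a_sub
  field_simp
  linear_combination -he

theorem inv_sub_ne (h : SplitConfig q a b d G H H' A S Ψ t t') : a⁻¹ - a ≠ 0 := by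
  rw [← neg_sub]; exact neg_ne_zero.2 h.a_sub

theorem isUnit [FiniteDimensional F V] (h : SplitConfig q a b d G H H' A S Ψ t t')
    (hK : Links q d G H K) : IsUnit K :=
  hK.start.isUnit h.tri.flagG fun _ _ => weight_ne_zero h.q_ne _ _

theorem lowerRelation (h : SplitConfig q a b d G H H' A S Ψ t t') (hK : Links q d G H K) :
    LowerRelation q a K A :=
  h.tri.links_relation hK h.q_ne h.q_pow h.a_ne fun _ _ => rfl

theorem lowerRelation_inverse (h : SplitConfig q a b d G H H' A S Ψ t t') (hK : Links q d G H K)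
    {X : Module.End F V} (hXK : X * K = 1) : LowerRelation q b⁻¹ X S :=
  h.tri.symm.links_relation (hK.symm h.q_ne h.tri.flagG h.tri.flagH hXK) h.q_ne h.q_pow
    (inv_ne_zero h.b_ne) fun _ _ => by rw [inv_inv, add_comm]

theorem conj (h : SplitConfig q a b d G H H' A S Ψ t t') (hK : Links q d G H K)
    {X : Module.End F V} (hXK : X * K = 1) (hKX : K * X = 1) :
    Ψ * K = (a⁻¹ • A - (a ^ 2)⁻¹ • X) * Ψ :=
  conj_eq_shift h.q_ne h.a_ne h.tri.flagH h.tri.triH hK.target h.trit h.comm (h.lowerRelation hK)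
    hXK hKX (fun _ => inv_ne_zero (weight_ne_zero h.q_ne _ _))
    (fun _ _ hij he => hij.ne (weight_injective h.q_ne h.q_pow (inv_injective he)))
    (fun n => by
      have := pow_ne_zero 2 h.q_ne
      rw [weight_succ h.q_ne d n, mul_inv, mul_inv_cancel_left₀ this])
    (fun _ _ => by rw [inv_inv]) h.inj h.t_succ

/-- The flag that starts at the lower end point. -/
abbrev lowerFlag (Ψ : Module.End F V) (G : ℕ → Submodule F V) (n : ℕ) : Submodule F V :=
  (G n).map Ψ

theorem links_shift (h : SplitConfig q a b d G H H' A S Ψ t t') (hK : Links q d G H K)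
    {X : Module.End F V} (hXK : X * K = 1) (hKX : K * X = 1) :
    Links q d (lowerFlag Ψ G) H (a⁻¹ • A - (a ^ 2)⁻¹ • X) where
  start := hK.start.conj (h.conj hK hXK hKX)
  target := Triangular.shift h.tri.flagH h.tri.triH hK.target hXK
    (fun _ => inv_ne_zero (weight_ne_zero h.q_ne _ _)) (fun _ _ => by rw [inv_inv]) h.a_ne

variable {X Z : Module.End F V}

/-- The two occurrences of `A` cancel. The same map is thus a combination of the inverses and of the
shifted maps, which is how it sees both the upper and the lower flag. -/
theorem mapN_eq_shift (h : SplitConfig q a b d G H H' A S Ψ t t') :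
    (a⁻¹ - a)⁻¹ • (a⁻¹ • X - a • Z) = (a⁻¹ - a)⁻¹ •
      (a⁻¹ • (a • A - a ^ 2 • Z) - a • (a⁻¹ • A - (a ^ 2)⁻¹ • X)) := by
  have ha := h.a_ne
  congr 1
  match_scalars <;> field_simp
  ring

/-- In each of the two forms the combined maps have equal diagonal scalars on the flag concerned,
and the coefficients sum to one after normalization. -/
theorem links_mapN (h : SplitConfig q a b d G H H' A S Ψ t t') (hK : Links q d G H K)
    (hB : Links q d G H' B) (hXK : X * K = 1) (hKX : K * X = 1) (hZB : Z * B = 1)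
    (hBZ : B * Z = 1) : Links q d (lowerFlag Ψ G) G ((a⁻¹ - a)⁻¹ • (a⁻¹ • X - a • Z)) where
  start := by
    rw [h.mapN_eq_shift (X := X) (Z := Z)]
    have h1 := (h.links_shift hK hXK hKX).start
    have h2 := (h.swap.links_shift hB hZB hBZ).start
    rw [inv_inv, inv_pow, inv_inv] at h2
    intro n
    have h3 := ((h2.smul a⁻¹).sub (h1.smul a)).smul (a⁻¹ - a)⁻¹ n
    simp only [← sub_mul, inv_mul_cancel_left₀ h.inv_sub_ne] at h3
    exact h3
  target := by
    have h1 := (hK.symm h.q_ne h.tri.flagG h.tri.flagH hXK).target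
    have h2 := (hB.symm h.q_ne h.tri.flagG h.tri'.flagH hZB).target
    intro n
    have h3 := ((h1.smul a⁻¹).sub (h2.smul a)).smul (a⁻¹ - a)⁻¹ n
    simp only [← sub_mul, inv_mul_cancel_left₀ h.inv_sub_ne] at h3
    exact h3

theorem splitQuadratic_eq_zero (h : SplitConfig q a b d G H H' A S Ψ t t') (hK : Links q d G H K)
    (hB : Links q d G H' B) (hXK : X * K = 1) (hKX : K * X = 1) (hZB : Z * B = 1)
    (hBZ : B * Z = 1) :
    splitQuadratic q ((q - q⁻¹ * a ^ 2) / (1 - a ^ 2)) K B = 0 :=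
  OnsagerDiagram.splitQuadratic_eq_zero h.irr h.q_ne h.a_ne h.one_sub_ne h.b_ne
    (h.lowerRelation hK) (h.swap.lowerRelation hB)
    (raiseRelation_of_inverse hXK hKX (h.lowerRelation_inverse hK hXK))
    (raiseRelation_of_inverse hZB hBZ (h.swap.lowerRelation_inverse hB hZB))
    h.tri.flagG h.G_top hK.start hB.start

/-- The inverses satisfy the same hypotheses with `q`, `a`, `b` inverted, and they still share
diagonal scalars on `G`. -/
theorem splitQuadratic_inverse_eq_zero (h : SplitConfig q a b d G H H' A S Ψ t t')
    (hK : Links q d G H K) (hB : Links q d G H' B) (hXK : X * K = 1) (hKX : K * X = 1)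
    (hZB : Z * B = 1) (hBZ : B * Z = 1) :
    splitQuadratic q⁻¹ ((q⁻¹ - q⁻¹⁻¹ * a⁻¹ ^ 2) / (1 - a⁻¹ ^ 2)) X Z = 0 :=
  OnsagerDiagram.splitQuadratic_eq_zero h.irr (inv_ne_zero h.q_ne) (inv_ne_zero h.a_ne)
    h.swap.one_sub_ne (inv_ne_zero h.b_ne)
    ((h.lowerRelation hK).inverse hXK hKX) ((h.swap.lowerRelation hB).inverse hZB hBZ)
    (raiseRelation_inverse (h.lowerRelation_inverse hK hXK))
    (raiseRelation_inverse (h.swap.lowerRelation_inverse hB hZB))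
    h.tri.flagG h.G_top (hK.symm h.q_ne h.tri.flagG h.tri.flagH hXK).target
    (hB.symm h.q_ne h.tri.flagG h.tri'.flagH hZB).target

theorem splitQuadratic_conj {e : F} {K' B' : Module.End F V} (hΨ : IsUnit Ψ)
    (hK : Ψ * K = K' * Ψ) (hB : Ψ * B = B' * Ψ) (h : splitQuadratic q e K B = 0) :
    splitQuadratic q e K' B' = 0 := by
  have key : ∀ {X Y X' Y' : Module.End F V}, Ψ * X = X' * Ψ → Ψ * Y = Y' * Ψ →
      X' * Y' * Ψ = Ψ * (X * Y) := by
    intro X Y X' Y' h1 h2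
    rw [mul_assoc, ← h2, ← mul_assoc, ← h1, mul_assoc]
  rw [← hΨ.mul_left_inj, zero_mul, splitQuadratic]
  simp only [sub_mul, add_mul, smul_mul_assoc, key hK hK, key hB hB, key hB hK, key hK hB]
  have h' := congrArg (Ψ * ·) h
  simpa only [splitQuadratic, mul_sub, mul_add, mul_smul_comm, mul_zero] using h'

/-- The maps represented by the edges of an oriented 3-cycle form an equitable triple. -/
theorem isEquitableTriple [FiniteDimensional F V] (h : SplitConfig q a b d G H H' A S Ψ t t')
    (hK : Links q d G H K) (hB : Links q d G H' B) :
    IsEquitableTriple q (Ring.inverse (mapN a K B)) (a⁻¹ • A - (a ^ 2)⁻¹ • Ring.inverse K)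
      (Ring.inverse K) := by
  have hKu := h.isUnit hK
  have hBu := h.swap.isUnit hB
  have hXK := Ring.inverse_mul_cancel K hKu
  have hKX := Ring.mul_inverse_cancel K hKu
  have hZB := Ring.inverse_mul_cancel B hBu
  have hBZ := Ring.mul_inverse_cancel B hBu
  have hNlink := h.links_mapN hK hB hXK hKX hZB hBZ
  have hNu : IsUnit (mapN a K B) := hNlink.target.isUnit h.tri.flagG
    fun _ _ => inv_ne_zero (weight_ne_zero h.q_ne _ _)
  have hMN := Ring.inverse_mul_cancel _ hNu
  have hNM := Ring.mul_inverse_cancel _ hNu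
  have hY := (h.links_shift hK hXK hKX).target.isUnit h.tri.flagH
    fun _ _ => inv_ne_zero (weight_ne_zero h.q_ne _ _)
  refine ⟨hNu.ringInverse, hY, hKu.ringInverse, ?_, ?_, ?_⟩
  -- The quadratic relation for `K`, `B`, transported by `Ψ` to their shifted maps.
  · refine qWeyl_of_mul_inverse h.q_sub_ne hMN hNM ?_
    have hBc := h.swap.conj hB hZB hBZ
    rw [inv_inv, inv_pow, inv_inv] at hBc
    exact weyl_of_splitQuadratic h.a_ne h.one_sub_ne
      (splitQuadratic_conj h.unit (h.conj hK hXK hKX) hBc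
        (h.splitQuadratic_eq_zero hK hB hXK hKX hZB hBZ)) h.mapN_eq_shift
  · rw [QWeyl, inv_smul_eq_iff₀ h.q_sub_ne]
    exact (h.lowerRelation hK).weyl h.a_ne hXK hKX
  -- The quadratic relation for the inverses, whose parameters are inverted; `mapN` is unchanged
  -- when `a` is inverted and its two arguments are exchanged.
  · refine qWeyl_inverse_of_mul h.q_sub_ne hMN hNM ?_
    have h1 := weyl_of_splitQuadratic (N := mapN a K B) (inv_ne_zero h.a_ne) h.swap.one_sub_ne
      (h.splitQuadratic_inverse_eq_zero hK hB hXK hKX hZB hBZ) (by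
        rw [mapN, inv_inv, ← neg_sub a a⁻¹, inv_neg]
        module)
    rw [inv_inv] at h1
    have e : q • (mapN a K B * Ring.inverse K) - q⁻¹ • (Ring.inverse K * mapN a K B) =
        -(q⁻¹ • (Ring.inverse K * mapN a K B) - q • (mapN a K B * Ring.inverse K)) := by abel
    rw [e, h1]
    module

theorem isUnit_mapN [FiniteDimensional F V] (h : SplitConfig q a b d G H H' A S Ψ t t')
    (hK : Links q d G H K) (hB : Links q d G H' B) : IsUnit (mapN a K B) :=
  (h.links_mapN hK hB (Ring.inverse_mul_cancel K (h.isUnit hK))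
    (Ring.mul_inverse_cancel K (h.isUnit hK)) (Ring.inverse_mul_cancel B (h.swap.isUnit hB))
    (Ring.mul_inverse_cancel B (h.swap.isUnit hB))).target.isUnit h.tri.flagG
    fun _ _ => inv_ne_zero (weight_ne_zero h.q_ne _ _)

theorem mapN_swap (a : F) (K B : Module.End F V) : mapN a⁻¹ B K = mapN a K B := by
  rw [mapN, mapN, inv_inv, ← neg_sub a a⁻¹, inv_neg]
  module

theorem isEquitableTriple_swap [FiniteDimensional F V]
    (h : SplitConfig q a b d G H H' A S Ψ t t') (hK : Links q d G H K) (hB : Links q d G H' B) :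
    IsEquitableTriple q (Ring.inverse (mapN a K B)) (a • A - a ^ 2 • Ring.inverse B)
      (Ring.inverse B) := by
  have := h.swap.isEquitableTriple hB hK
  rwa [mapN_swap, inv_inv, inv_pow, inv_inv] at this

end SplitConfig

end SplitConfig

end OnsagerDiagram

namespace OnsagerDiagram

/-! ### Eigenvalues, tridiagonal action and the Lusztig map -/

section Eigenvalues

variable {F V : Type*} [Field F] [AddCommGroup V] [Module F V]
variable {q : F} {d : ℕ} {T S : Module.End F V} {θ : ℕ → F}

theorem sq_sub_inv_sq_ne_zero (hq0 : q ≠ 0) (hq : ∀ n : ℕ, 0 < n → q ^ n ≠ 1) :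
    q ^ 2 - (q ^ 2)⁻¹ ≠ 0 := by
  intro he
  apply hq 4 (by norm_num)
  field_simp at he
  linear_combination he

/-- Consecutive adjacency determines the eigenvalues up to one parameter. -/
theorem exists_parameter (hq0 : q ≠ 0) (hq : ∀ n : ℕ, 0 < n → q ^ n ≠ 1) (hd : 1 ≤ d)
    (h : IsStandardOrdering q T d θ) :
    ∃ a : F, a ≠ 0 ∧ a - a⁻¹ ≠ 0 ∧
      ∀ i ≤ d, θ i = a * weight q d i + a⁻¹ * (weight q d i)⁻¹ := by
  have hs := sq_sub_inv_sq_ne_zero hq0 hq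
  have hw := weight_ne_zero hq0 d 0
  have hw1 : weight q d 0 = q ^ 2 * weight q d 1 := weight_succ hq0 d 0
  have hw1' := weight_ne_zero hq0 d 1
  set s := q ^ 2 - (q ^ 2)⁻¹ with hsdef
  -- `u`, `v` solve the linear system `θ i = u w_i + v w_i⁻¹` for `i = 0, 1`, where `w_i` is the
  -- weight; adjacency of `θ 0` and `θ 1` becomes `u v = 1`.
  set u := (q ^ 2 * θ 0 - θ 1) / (s * weight q d 0) with hu
  set v := (θ 1 - (q ^ 2)⁻¹ * θ 0) * weight q d 0 / s with hv
  have hadj := h.adjacent 0 (by omega)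
  rw [adjPoly, ← hsdef, zero_add] at hadj
  have huv : u * v = 1 := by
    have h1 : u * v = ((q ^ 2 * θ 0 - θ 1) * (θ 1 - (q ^ 2)⁻¹ * θ 0)) / s ^ 2 := by
      rw [hu, hv]; field_simp
    have h2 : (q ^ 2 * θ 0 - θ 1) * (θ 1 - (q ^ 2)⁻¹ * θ 0) = s ^ 2 := by
      have : q ^ 2 * (q ^ 2)⁻¹ = 1 := mul_inv_cancel₀ (pow_ne_zero 2 hq0)
      linear_combination -hadj - θ 0 ^ 2 * this
    rw [h1, h2, div_self (pow_ne_zero 2 hs)]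
  have hu0 : u ≠ 0 := left_ne_zero_of_mul_eq_one huv
  have hvu : v = u⁻¹ := (inv_eq_of_mul_eq_one_right huv).symm
  have hform : ∀ i ≤ d, θ i = u * weight q d i + u⁻¹ * (weight q d i)⁻¹ := by
    have e0 : θ 0 = u * weight q d 0 + u⁻¹ * (weight q d 0)⁻¹ := by
      rw [← hvu, hu, hv]
      field_simp
      rw [hsdef]
      field_simp
      ring
    have e1 : θ 1 = u * weight q d 1 + u⁻¹ * (weight q d 1)⁻¹ := by
      rw [← hvu, hu, hv, hw1]
      field_simp
      rw [hsdef]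
      field_simp
      ring
    have key : ∀ i, i + 1 ≤ d → θ i = u * weight q d i + u⁻¹ * (weight q d i)⁻¹ ∧
        θ (i + 1) = u * weight q d (i + 1) + u⁻¹ * (weight q d (i + 1))⁻¹ := by
      intro i
      induction i with
      | zero => exact fun _ => ⟨e0, e1⟩
      | succ i ih =>
        intro hi
        obtain ⟨h1, h2⟩ := ih (by omega)
        refine ⟨h2, ?_⟩
        have a1 := h.adjacent i (by omega)
        have a2 := h.adjacent (i + 1) (by omega)
        rw [adjPoly] at a1 a2
        have hne : θ (i + 1 + 1) - θ i ≠ 0 := by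
          intro he
          have := h.injective _ hi _ (by omega) (sub_eq_zero.1 he)
          omega
        -- `θ i` and `θ (i + 2)` are distinct roots of one quadratic with middle coefficient given
        -- by `θ (i + 1)`; their sum is read off.
        have h3 : θ (i + 1 + 1) = (q ^ 2 + (q ^ 2)⁻¹) * θ (i + 1) - θ i := by
          have : (θ (i + 1 + 1) - θ i) *
              (θ (i + 1 + 1) - ((q ^ 2 + (q ^ 2)⁻¹) * θ (i + 1) - θ i)) = 0 := by
            linear_combination a2 - a1
          exact sub_eq_zero.1 ((mul_eq_zero.1 this).resolve_left hne)
        have hn := weight_ne_zero hq0 d (i + 1 + 1)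
        rw [h3, h1, h2, weight_succ hq0 d i, weight_succ hq0 d (i + 1)]
        field_simp
        ring
    intro i hi
    cases i with
    | zero => exact e0
    | succ i => exact (key i hi).2
  refine ⟨u, hu0, ?_, hform⟩
  -- If the parameter were its own inverse, reversing the index would not change the eigenvalue, so
  -- `θ 0 = θ d`.
  intro he
  have he' : u⁻¹ = u := (sub_eq_zero.1 he).symm
  have h0 := hform 0 (by omega)
  have hdd := hform d le_rfl
  have hwd : weight q d d = (weight q d 0)⁻¹ := by
    rw [← weight_sub (Nat.zero_le d), Nat.sub_zero]
  rw [hwd, inv_inv, he'] at hdd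
  rw [he'] at h0
  have := h.injective 0 (by omega) d le_rfl (by rw [h0, hdd, add_comm])
  omega

theorem adjPoly_comm (q x y : F) : adjPoly q x y = adjPoly q y x := by
  rw [adjPoly, adjPoly]; ring

/-- After clearing denominators the adjacency polynomial splits into four factors. Two compare
weights directly; the other two say that `θ i` or `θ j` coincides with an eigenvalue one index away
from the other, and are settled by injectivity. -/
theorem eq_succ_of_adjPoly_eq_zero (hq0 : q ≠ 0) (hq : ∀ n : ℕ, 0 < n → q ^ n ≠ 1) {a : F}
    (ha : a ≠ 0) (hθ : ∀ i ≤ d, θ i = a * weight q d i + a⁻¹ * (weight q d i)⁻¹)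
    (hinj : ∀ i ≤ d, ∀ j ≤ d, θ i = θ j → i = j) {i j : ℕ} (hij : i < j) (hj : j ≤ d)
    (h : adjPoly q (θ i) (θ j) = 0) : j = i + 1 := by
  have hwi := weight_ne_zero hq0 d i
  have hwj := weight_ne_zero hq0 d j
  have coincide : ∀ m n, m ≤ d → n ≤ d → a ^ 2 * weight q d m * weight q d n = 1 → m = n := by
    intro m n hm hn he
    refine hinj m hm n hn ?_
    have hwm := weight_ne_zero hq0 d m
    have hwn := weight_ne_zero hq0 d n
    rw [hθ m hm, hθ n hn]
    field_simp
    linear_combination (weight q d m - weight q d n) * he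
  have hfac : (weight q d i - q ^ 2 * weight q d j) * (q ^ 2 * weight q d i - weight q d j) *
      ((a ^ 2 * weight q d i * weight q d j - q ^ 2) *
        (q ^ 2 * (a ^ 2 * weight q d i * weight q d j) - 1)) = 0 := by
    rw [adjPoly, hθ i (by omega), hθ j hj] at h
    field_simp at h
    linear_combination h
  rcases mul_eq_zero.1 hfac with h1 | h1 <;> rcases mul_eq_zero.1 h1 with h2 | h2
  · rw [weight_succ hq0 d i, ← mul_sub] at h2
    have := (mul_eq_zero.1 h2).resolve_left (pow_ne_zero 2 hq0)
    exact (weight_injective hq0 hq (sub_eq_zero.1 this)).symm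
  · rw [weight_succ hq0 d j, ← mul_sub] at h2
    have := (mul_eq_zero.1 h2).resolve_left (pow_ne_zero 2 hq0)
    have := weight_injective hq0 hq (sub_eq_zero.1 this)
    omega
  · refine (coincide (i + 1) j (by omega) hj ?_).symm
    have h3 : q ^ 2 * (a ^ 2 * weight q d (i + 1) * weight q d j - 1) = 0 := by
      rw [weight_succ hq0 d i] at h2
      linear_combination h2
    exact sub_eq_zero.1 ((mul_eq_zero.1 h3).resolve_left (pow_ne_zero 2 hq0))
  · obtain ⟨k, rfl⟩ : ∃ k, j = k + 1 := ⟨j - 1, by omega⟩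
    rw [coincide i k (by omega) (by omega) ?_]
    rw [weight_succ hq0 d k]
    linear_combination h2

theorem isDecomposition_eigenspaceSeq (h : IsStandardOrdering q T d θ) (hT : IsDiagonalizable T) :
    IsDecomposition d (eigenspaceSeq T θ) := by
  refine ⟨fun i hi => h.hasEigenvalue i hi, ?_⟩
  rw [DirectSum.isInternal_submodule_iff_iSupIndep_and_iSup_eq_top]
  constructor
  · exact (Module.End.eigenspaces_iSupIndep T).comp (f := fun i : Fin (d + 1) => θ i)
      fun i j hij => Fin.ext (h.injective i (Nat.lt_succ_iff.1 i.2) j (Nat.lt_succ_iff.1 j.2) hij)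
  · rw [← top_le_iff]
    have hT' : ⨆ μ : F, T.eigenspace μ = ⊤ := hT
    rw [← hT']
    refine iSup_le fun μ => ?_
    by_cases hμ : T.HasEigenvalue μ
    · obtain ⟨i, hi, rfl⟩ := h.exhausts μ hμ
      exact le_iSup (fun i : Fin (d + 1) => eigenspaceSeq T θ i) ⟨i, by omega⟩
    · have : T.eigenspace μ = ⊥ := not_not.1 hμ
      rw [this]; exact bot_le

theorem inversion_inversion (W : ℕ → Submodule F V) {i : ℕ} (hi : i ≤ d) :
    inversion d (inversion d W) i = W i := by
  simp only [inversion]; congr 1; omega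

theorem IsDecomposition.end_ext {W : ℕ → Submodule F V} (hW : IsDecomposition d W)
    {X Y : Module.End F V} (h : ∀ i ≤ d, ∀ v ∈ W i, X v = Y v) : X = Y := by
  have h2 : (⊤ : Submodule F V) ≤ LinearMap.eqLocus X Y := by
    rw [← hW.2.submodule_iSup_eq_top]
    exact iSup_le fun i v hv => h i (Nat.lt_succ_iff.1 i.2) v hv
  ext v
  exact h2 (Submodule.mem_top : v ∈ ⊤)

/-- The sum of the `W i` with `i ≤ d` and `|i - j| ≤ 1`. -/
def nearSum (d : ℕ) (W : ℕ → Submodule F V) (j : ℕ) : Submodule F V :=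
  ⨆ i, ⨆ _ : i ≤ d ∧ i ≤ j + 1 ∧ j ≤ i + 1, W i

theorem nearSum_le {W : ℕ → Submodule F V} {j : ℕ} {M : Submodule F V}
    (h : ∀ i ≤ d, i ≤ j + 1 → j ≤ i + 1 → W i ≤ M) : nearSum d W j ≤ M :=
  iSup_le fun i => iSup_le fun hi => h i hi.1 hi.2.1 hi.2.2

theorem le_nearSum {W : ℕ → Submodule F V} {i j : ℕ} (h : i ≤ d) (h1 : i ≤ j + 1)
    (h2 : j ≤ i + 1) : W i ≤ nearSum d W j :=
  le_iSup_of_le i (le_iSup_of_le ⟨h, h1, h2⟩ le_rfl)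

theorem nearSum_inversion {W : ℕ → Submodule F V}
    (h : ∀ j ≤ d, ∀ v ∈ W j, S v ∈ nearSum d W j) :
    ∀ j ≤ d, ∀ v ∈ inversion d W j, S v ∈ nearSum d (inversion d W) j := by
  intro j hj v hv
  refine nearSum_le (fun i hi h1 h2 => ?_) (h (d - j) (Nat.sub_le _ _) v hv)
  rw [← inversion_inversion W hi]
  exact le_nearSum (W := inversion d W) (Nat.sub_le _ _) (by omega) (by omega)

theorem partialSum_raise {W : ℕ → Submodule F V} (hW : IsDecomposition d W)
    (h : ∀ j ≤ d, ∀ v ∈ W j, S v ∈ nearSum d W j) :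
    ∀ n, ∀ v ∈ partialSum W n, S v ∈ partialSum W (n + 1) := by
  intro n v hv
  rcases le_or_gt n d with hn | hn
  · have : partialSum W n ≤ (partialSum W (n + 1)).comap S := by
      refine iSup₂_le fun j hj w hw => ?_
      have hj' := Finset.mem_range.1 hj
      exact nearSum_le (fun i _ h1 _ => le_partialSum W (by omega)) (h j (by omega) w hw)
    exact this hv
  · rw [hW.isFlag.top _ (by omega)]; trivial

open Polynomial in
theorem aeval_apply_of_eigen {μ : F} {v : V} (h : T v = μ • v) (p : F[X]) :
    aeval T p v = p.eval μ • v := by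
  by_cases hv : v = 0
  · simp [hv]
  · exact Module.End.aeval_apply_of_hasEigenvector ⟨Module.End.mem_eigenspace_iff.2 h, hv⟩

-- Lagrange basis polynomials evaluated at `T` project onto the eigenspaces; `p(T) w = 0` kills the
-- components whose eigenvalue is not a root of `p`.
open Polynomial in
theorem mem_iSup_of_aeval_eq_zero (hdec : IsDecomposition d (eigenspaceSeq T θ))
    (hinj : ∀ i ≤ d, ∀ j ≤ d, θ i = θ j → i = j) {p : F[X]} {w : V} (hp : aeval T p w = 0)
    {M : Submodule F V} (hM : ∀ i ≤ d, p.eval (θ i) = 0 → eigenspaceSeq T θ i ≤ M) : w ∈ M := by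
  have hinj' : Set.InjOn θ (Finset.range (d + 1)) := fun i hi j hj he =>
    hinj i (by simpa [Nat.lt_succ_iff] using hi) j (by simpa [Nat.lt_succ_iff] using hj) he
  set L := fun i => Lagrange.basis (Finset.range (d + 1)) θ i with hL
  have hLeval : ∀ i ≤ d, ∀ j ≤ d, (L i).eval (θ j) = if i = j then 1 else 0 := by
    intro i hi j hj
    split_ifs with hij
    · subst hij
      exact Lagrange.eval_basis_self hinj' (Finset.mem_range.2 (by omega))
    · exact Lagrange.eval_basis_of_ne hij (Finset.mem_range.2 (by omega))
  have hcomm : ∀ i ≤ d, ∀ g : F[X], aeval T g * aeval T (L i) = g.eval (θ i) • aeval T (L i) := by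
    intro i hi g
    refine hdec.end_ext fun j hj v hv => ?_
    have hv' := Module.End.mem_eigenspace_iff.1 hv
    rw [← map_mul, LinearMap.smul_apply, aeval_apply_of_eigen hv', aeval_apply_of_eigen hv',
      eval_mul, hLeval i hi j hj]
    split_ifs with hij
    · simp [hij]
    · simp
  have hsum : w = ∑ i ∈ Finset.range (d + 1), aeval T (L i) w := by
    rw [← LinearMap.sum_apply, ← map_sum, hL, Lagrange.sum_basis hinj' ⟨0, by simp⟩]
    simp
  rw [hsum]
  refine Submodule.sum_mem _ fun i hi => ?_
  have hi' : i ≤ d := Nat.lt_succ_iff.1 (Finset.mem_range.1 hi)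
  by_cases h0 : p.eval (θ i) = 0
  · refine hM i hi' h0 (Module.End.mem_eigenspace_iff.2 ?_)
    have := LinearMap.congr_fun (hcomm i hi' X) w
    simpa using this
  · have h1 : aeval T p (aeval T (L i) w) = p.eval (θ i) • aeval T (L i) w :=
      LinearMap.congr_fun (hcomm i hi' p) w
    rw [← Module.End.mul_apply, ← map_mul, mul_comm, map_mul, Module.End.mul_apply, hp,
      map_zero] at h1
    rw [(smul_eq_zero.1 h1.symm).resolve_left h0]
    exact Submodule.zero_mem _

/-- The q-Dolan/Grady relation `[A, [A, [A, S]_q]_{q⁻¹}] = (q² - q⁻²)² [S, A]`. -/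
def DolanGrady (q : F) (A S : Module.End F V) : Prop :=
  ringComm A (qComm q⁻¹ A (qComm q A S)) = (q ^ 2 - (q ^ 2)⁻¹) ^ 2 • ringComm S A

-- On an eigenvector for `θ j` the relation becomes `p(T) (S v) = 0` with `p(x) = (x - θ j) P(x, θ
-- j)`, and the eigenvalues that are roots of `p` have index within one of `j`.
open Polynomial in
theorem DolanGrady.mem_nearSum (hq0 : q ≠ 0) (hq : ∀ n : ℕ, 0 < n → q ^ n ≠ 1)
    (hDG : DolanGrady q T S) (hdec : IsDecomposition d (eigenspaceSeq T θ)) {a : F} (ha : a ≠ 0)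
    (hθ : ∀ i ≤ d, θ i = a * weight q d i + a⁻¹ * (weight q d i)⁻¹)
    (hinj : ∀ i ≤ d, ∀ j ≤ d, θ i = θ j → i = j) :
    ∀ j ≤ d, ∀ v ∈ eigenspaceSeq T θ j, S v ∈ nearSum d (eigenspaceSeq T θ) j := by
  intro j hj v hv
  have hv' : T v = θ j • v := Module.End.mem_eigenspace_iff.1 hv
  refine mem_iSup_of_aeval_eq_zero hdec hinj (p := (X - C (θ j)) *
    (X ^ 2 - C ((q ^ 2 + (q ^ 2)⁻¹) * θ j) * X + C (θ j ^ 2 + (q ^ 2 - (q ^ 2)⁻¹) ^ 2))) ?_ ?_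
  · have h1 := LinearMap.congr_fun hDG v
    simp only [ringComm, qComm, LinearMap.sub_apply, LinearMap.smul_apply, Module.End.mul_apply,
      map_sub, map_smul, hv', inv_inv] at h1
    simp only [map_mul, map_sub, map_add, aeval_X, aeval_C, Module.End.mul_apply,
      LinearMap.sub_apply, LinearMap.add_apply, Module.algebraMap_end_apply, pow_two, map_smul]
    rw [← sub_eq_zero] at h1
    rw [← h1]
    match_scalars <;> field_simp <;> ring
  · intro i hi h0
    have h0' : (θ i - θ j) * adjPoly q (θ i) (θ j) = 0 := by
      rw [← h0, adjPoly]
      simp only [eval_mul, eval_sub, eval_add, eval_pow, eval_X, eval_C]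
      ring
    rcases mul_eq_zero.1 h0' with h1 | h1
    · obtain rfl := hinj i hi j hj (sub_eq_zero.1 h1)
      exact le_nearSum hi (by omega) (by omega)
    · rcases lt_trichotomy i j with hij | rfl | hij
      · have := eq_succ_of_adjPoly_eq_zero hq0 hq ha hθ hinj hij hj h1
        exact le_nearSum hi (by omega) (by omega)
      · exact le_nearSum hi (by omega) (by omega)
      · rw [adjPoly_comm] at h1
        have := eq_succ_of_adjPoly_eq_zero hq0 hq ha hθ hinj hij hi h1
        exact le_nearSum hi (by omega) (by omega)

/-- The image of `S` under the Lusztig automorphism that fixes `A`. -/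
def lusztig (q : F) (A S : Module.End F V) : Module.End F V :=
  S + ((q - q⁻¹) * (q ^ 2 - (q ^ 2)⁻¹))⁻¹ • ringComm A (qComm q A S)

/-- The eigenvalue `a^(-2i) q^(2i(i-d))` of the map that implements the Lusztig automorphism. -/
def lusztigWeight (q a : F) (d i : ℕ) : F :=
  (a ^ (2 * i))⁻¹ * q ^ (2 * (i : ℤ) * ((i : ℤ) - (d : ℤ)))

theorem lusztigWeight_ne_zero (hq0 : q ≠ 0) {a : F} (ha : a ≠ 0) (d i : ℕ) :
    lusztigWeight q a d i ≠ 0 :=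
  mul_ne_zero (inv_ne_zero (pow_ne_zero _ ha)) (zpow_ne_zero _ hq0)

theorem lusztigWeight_succ (hq0 : q ≠ 0) (a : F) (d i : ℕ) :
    lusztigWeight q a d (i + 1) =
      (a ^ 2)⁻¹ * (weight q d i)⁻¹ * (weight q d (i + 1))⁻¹ * lusztigWeight q a d i := by
  rw [weight_inv, weight_inv, lusztigWeight, lusztigWeight]
  have e : q ^ (2 * ((i + 1 : ℕ) : ℤ) * (((i + 1 : ℕ) : ℤ) - (d : ℤ))) =
      q ^ (2 * (i : ℤ) - d) * q ^ (2 * ((i + 1 : ℕ) : ℤ) - d) *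
        q ^ (2 * (i : ℤ) * ((i : ℤ) - (d : ℤ))) := by
    rw [← zpow_add₀ hq0, ← zpow_add₀ hq0]
    congr 1
    push_cast
    ring
  rw [e, mul_add, pow_add, mul_inv, mul_one]
  ring

/-- The recursion read from the other end, as the reversed flag of A requires; `a` is inverted in
it. -/
theorem lusztigWeight_sub (hq0 : q ≠ 0) {a : F} (ha : a ≠ 0) {n : ℕ} (hn : n < d) :
    lusztigWeight q a d (d - (n + 1)) =
      a ^ 2 * (weight q d n)⁻¹ * (weight q d (n + 1))⁻¹ * lusztigWeight q a d (d - n) := by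
  obtain ⟨k, hk⟩ : ∃ k, d - n = k + 1 := ⟨d - n - 1, by omega⟩
  have hk' : d - (n + 1) = k := by omega
  have h1 : weight q d (k + 1) = (weight q d n)⁻¹ := by rw [← hk, weight_sub hn.le]
  have h2 : weight q d k = (weight q d (n + 1))⁻¹ := by rw [← hk', weight_sub hn]
  rw [hk', hk, lusztigWeight_succ hq0, h1, h2]
  have := weight_ne_zero hq0 d n
  have := weight_ne_zero hq0 d (n + 1)
  field_simp

-- `Ψ` is an interpolation polynomial in `T`, hence commutes with `T`; interpolating the inverse
-- values gives its inverse.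
open Polynomial in
theorem exists_lusztig_map [FiniteDimensional F V]
    (hdec : IsDecomposition d (eigenspaceSeq T θ))
    (hinj : ∀ i ≤ d, ∀ j ≤ d, θ i = θ j → i = j) (t : ℕ → F) (ht : ∀ i, t i ≠ 0) :
    ∃ Ψ : Module.End F V, IsUnit Ψ ∧ Ψ * T = T * Ψ ∧
      ∀ i ≤ d, ∀ v ∈ eigenspaceSeq T θ i, Ψ v = t i • v := by
  have hinj' : Set.InjOn θ (Finset.range (d + 1)) := fun i hi j hj he =>
    hinj i (by simpa [Nat.lt_succ_iff] using hi) j (by simpa [Nat.lt_succ_iff] using hj) he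
  have hev : ∀ t : ℕ → F, ∀ i ≤ d, ∀ v ∈ eigenspaceSeq T θ i,
      aeval T (Lagrange.interpolate (Finset.range (d + 1)) θ t) v = t i • v := by
    intro t i hi v hv
    rw [aeval_apply_of_eigen (Module.End.mem_eigenspace_iff.1 hv),
      Lagrange.eval_interpolate_at_node t hinj' (Finset.mem_range.2 (by omega))]
  have hinv : ∀ t : ℕ → F, (∀ i, t i ≠ 0) →
      aeval T (Lagrange.interpolate (Finset.range (d + 1)) θ t) *
        aeval T (Lagrange.interpolate (Finset.range (d + 1)) θ t⁻¹) = 1 := by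
    intro t ht
    refine hdec.end_ext fun i hi v hv => ?_
    rw [Module.End.mul_apply, hev _ i hi v hv, map_smul, hev _ i hi v hv, Pi.inv_apply,
      inv_smul_smul₀ (ht i), Module.End.one_apply]
  refine ⟨aeval T (Lagrange.interpolate (Finset.range (d + 1)) θ t), ?_, ?_, hev t⟩
  · refine IsUnit.of_mul_eq_one _ (hinv t ht)
  · simpa using congrArg (aeval T)
      (mul_comm (Lagrange.interpolate (Finset.range (d + 1)) θ t) X)

/-- On the eigenspace for `θ j`, the Lusztig image acts as `S` followed by a polynomial in `T`. That
polynomial multiplies the component of index `i` by the ratio of the weights of `Ψ` at `i` and `j`;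
tridiagonality leaves only `|i - j| ≤ 1` to check. -/
theorem lusztig_conj (hq0 : q ≠ 0) (hq : ∀ n : ℕ, 0 < n → q ^ n ≠ 1) {Ψ : Module.End F V}
    (hdec : IsDecomposition d (eigenspaceSeq T θ)) {a : F} (ha : a ≠ 0)
    (hθ : ∀ i ≤ d, θ i = a * weight q d i + a⁻¹ * (weight q d i)⁻¹)
    (hnear : ∀ j ≤ d, ∀ v ∈ eigenspaceSeq T θ j, S v ∈ nearSum d (eigenspaceSeq T θ) j)
    (hΨ : ∀ i ≤ d, ∀ v ∈ eigenspaceSeq T θ i, Ψ v = lusztigWeight q a d i • v) :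
    lusztig q T S * Ψ = Ψ * S := by
  have hs := sq_sub_inv_sq_ne_zero hq0 hq
  have hc : q - q⁻¹ ≠ 0 := by
    intro he
    apply hq 2 (by norm_num)
    field_simp at he
    linear_combination he
  refine hdec.end_ext fun j hj v hv => ?_
  have hTv : T v = θ j • v := Module.End.mem_eigenspace_iff.1 hv
  set γ := ((q - q⁻¹) * (q ^ 2 - (q ^ 2)⁻¹))⁻¹ with hγ
  set g : Module.End F V := 1 + γ • ((T - θ j • 1) * (q • T - (q⁻¹ * θ j) • 1)) with hg
  have h1 : lusztig q T S v = g (S v) := by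
    simp only [lusztig, ringComm, qComm, hg, ← hγ, LinearMap.add_apply, LinearMap.sub_apply,
      LinearMap.smul_apply, Module.End.mul_apply, Module.End.one_apply, hTv, map_sub, map_smul]
    module
  rw [Module.End.mul_apply, Module.End.mul_apply, hΨ j hj v hv, map_smul, h1]
  have key : nearSum d (eigenspaceSeq T θ) j ≤
      LinearMap.eqLocus (lusztigWeight q a d j • g) Ψ := by
    refine nearSum_le fun i hi hi1 hi2 u hu => ?_
    have hTu : T u = θ i • u := Module.End.mem_eigenspace_iff.1 hu
    have hgu : g u = (1 + γ * ((q * θ i - q⁻¹ * θ j) * (θ i - θ j))) • u := by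
      simp only [hg, LinearMap.add_apply, LinearMap.sub_apply, LinearMap.smul_apply,
        Module.End.mul_apply, Module.End.one_apply, hTu, map_sub, map_smul]
      module
    rw [LinearMap.mem_eqLocus, LinearMap.smul_apply, hgu, hΨ i hi u hu, smul_smul]
    congr 1
    have hwi := weight_ne_zero hq0 d i
    have hwj := weight_ne_zero hq0 d j
    have hγ' : γ * ((q - q⁻¹) * (q ^ 2 - (q ^ 2)⁻¹)) = 1 :=
      inv_mul_cancel₀ (mul_ne_zero hc hs)
    obtain rfl | rfl | rfl : i = j ∨ i = j + 1 ∨ j = i + 1 := by omega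
    · ring
    · rw [lusztigWeight_succ hq0, mul_comm (lusztigWeight q a d j)]
      congr 1
      have e : (q * θ (j + 1) - q⁻¹ * θ j) * (θ (j + 1) - θ j) =
          ((q - q⁻¹) * (q ^ 2 - (q ^ 2)⁻¹)) *
            ((a ^ 2)⁻¹ * (weight q d j)⁻¹ * (weight q d (j + 1))⁻¹ - 1) := by
        rw [hθ _ hi, hθ _ hj, weight_succ hq0 d j]
        field_simp
        ring
      rw [e]
      linear_combination ((a ^ 2)⁻¹ * (weight q d j)⁻¹ * (weight q d (j + 1))⁻¹ - 1) * hγ'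
    · rw [lusztigWeight_succ hq0]
      have e : (q * θ i - q⁻¹ * θ (i + 1)) * (θ i - θ (i + 1)) =
          ((q - q⁻¹) * (q ^ 2 - (q ^ 2)⁻¹)) *
            (a ^ 2 * weight q d i * weight q d (i + 1) - 1) := by
        rw [hθ _ hi, hθ _ hj, weight_succ hq0 d i]
        field_simp
        ring
      have e2 : 1 + γ * ((q * θ i - q⁻¹ * θ (i + 1)) * (θ i - θ (i + 1))) =
          a ^ 2 * weight q d i * weight q d (i + 1) := by
        rw [e]
        linear_combination (a ^ 2 * weight q d i * weight q d (i + 1) - 1) * hγ'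
      rw [e2]
      field_simp
  exact key (hnear j hj v hv)

end Eigenvalues

end OnsagerDiagram

namespace OnsagerDiagram

/-! ### Assembling the diagram -/

section Assembly

variable {F V : Type*} [Field F] [AddCommGroup V] [Module F V]
variable {q a b : F} {d : ℕ} {A S Ψ : Module.End F V} {θ : ℕ → F}

theorem IsDecomposition.partialSum_one_ne_bot {W : ℕ → Submodule F V} (hW : IsDecomposition d W) :
    partialSum W 1 ≠ ⊥ := fun h => hW.not_le (Nat.zero_le d) (by rw [zero_add, h]; exact bot_le)

theorem IsDecomposition.partialSum_ne_top {W : ℕ → Submodule F V} (hW : IsDecomposition d W) :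
    partialSum W d ≠ ⊤ := fun h => hW.not_le le_rfl (by rw [h]; exact le_top)

theorem partialSum_map (Ψ : Module.End F V) (W : ℕ → Submodule F V) :
    partialSum (fun i => (W i).map Ψ) = SplitConfig.lowerFlag Ψ (partialSum W) := by
  funext n
  simp only [partialSum, SplitConfig.lowerFlag, Submodule.map_iSup]

theorem IsDecomposition.map {W : ℕ → Submodule F V} (hW : IsDecomposition d W) (hΨ : IsUnit Ψ) :
    IsDecomposition d (fun i => (W i).map Ψ) := by
  obtain ⟨u, rfl⟩ := hΨ
  let e : V ≃ₗ[F] V := LinearMap.GeneralLinearGroup.generalLinearEquiv F V u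
  have he : (u : Module.End F V) = e.toLinearMap := by ext; rfl
  rw [he]
  refine ⟨fun i hi h => hW.1 i hi ?_, ?_⟩
  · exact (Submodule.map_eq_bot_iff (e := e)).1 h
  · have h2 := hW.2
    rw [DirectSum.isInternal_submodule_iff_iSupIndep_and_iSup_eq_top] at h2 ⊢
    refine ⟨h2.1.map_orderIso (Submodule.orderIsoMapComap e), ?_⟩
    rw [← Submodule.map_iSup, h2.2, Submodule.map_top, LinearEquiv.range]

/-- This identifies the decompositions at the bottom vertices with the images under `Ψ` of those at
the top. -/
theorem eigenspaceSeq_conj {T T' : Module.End F V} (hΨ : IsUnit Ψ) (h : T' * Ψ = Ψ * T)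
    (θ : ℕ → F) : eigenspaceSeq T' θ = fun i => (eigenspaceSeq T θ i).map Ψ := by
  have h' : ∀ v, T' (Ψ v) = Ψ (T v) := LinearMap.congr_fun h
  have hbij := (Module.End.isUnit_iff Ψ).1 hΨ
  funext i
  ext v
  constructor
  · intro hv
    obtain ⟨w, rfl⟩ := hbij.2 v
    refine ⟨w, Module.End.mem_eigenspace_iff.2 (hbij.1 ?_), rfl⟩
    rw [← h', map_smul]
    exact Module.End.mem_eigenspace_iff.1 hv
  · rintro ⟨w, hw, rfl⟩
    refine Module.End.mem_eigenspace_iff.2 ?_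
    have hw' : T w = θ i • w := Module.End.mem_eigenspace_iff.1 hw
    rw [h', hw', map_smul]

theorem IsIrreduciblePair.symm (h : IsIrreduciblePair A S) : IsIrreduciblePair S A :=
  fun M h1 h2 => h M h2 h1

/-- With a single eigenvalue `A` would be scalar, and any eigenvector of `S` would span an invariant
line. -/
theorem one_le_of_irreducible [FiniteDimensional F V] (hirr : IsIrreduciblePair A S)
    (hdim : 2 ≤ Module.finrank F V) (hA : IsDiagonalizable A) (hθ : IsStandardOrdering q A d θ)
    {μ : F} (hS : S.HasEigenvalue μ) : 1 ≤ d := by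
  by_contra hd
  obtain rfl : d = 0 := by omega
  have htop := (isDecomposition_eigenspaceSeq hθ hA).isFlag.top 1 one_pos
  have hAv : ∀ v, A v = θ 0 • v := by
    intro v
    have hv : v ∈ partialSum (eigenspaceSeq A θ) 1 := by rw [htop]; trivial
    simp only [partialSum, Finset.range_one, Finset.mem_singleton, iSup_iSup_eq_left] at hv
    exact Module.End.mem_eigenspace_iff.1 hv
  obtain ⟨v, hv⟩ := hS.exists_hasEigenvector
  have hstab : ∀ {T : Module.End F V} {c : F}, T v = c • v →
      ∀ w ∈ Submodule.span F {v}, T w ∈ Submodule.span F {v} := by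
    intro T c hT w hw
    obtain ⟨x, rfl⟩ := Submodule.mem_span_singleton.1 hw
    rw [map_smul, hT, smul_smul]
    exact Submodule.smul_mem _ _ (Submodule.mem_span_singleton_self v)
  rcases hirr (Submodule.span F {v}) (hstab (hAv v)) (hstab hv.apply_eq_smul) with h | h
  · exact hv.2 (Submodule.span_singleton_eq_bot.1 h)
  · have h1 := finrank_span_singleton (K := F) hv.2
    rw [h, finrank_top] at h1
    omega

/-- `W` is left free so that both the eigenspace decomposition of A* and its inversion can be
inserted. The first flag of A is the reversed one, so `K` belongs to the right end of the middle
segment and `B` to the left end. -/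
theorem splitConfig (hq0 : q ≠ 0) (hq : ∀ n : ℕ, 0 < n → q ^ n ≠ 1) (ha : a ≠ 0)
    (ha2 : a - a⁻¹ ≠ 0) (hb : b ≠ 0) (hirr : IsIrreduciblePair A S)
    (hE : IsDecomposition d (eigenspaceSeq A θ))
    (hθ : ∀ i ≤ d, θ i = a * weight q d i + a⁻¹ * (weight q d i)⁻¹)
    (hinj : ∀ i ≤ d, ∀ j ≤ d, θ i = θ j → i = j)
    (hES : ∀ j ≤ d, ∀ v ∈ eigenspaceSeq A θ j, S v ∈ nearSum d (eigenspaceSeq A θ) j)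
    {W : ℕ → Submodule F V} (hW : IsDecomposition d W)
    (hWA : ∀ j ≤ d, ∀ v ∈ W j, A v ∈ nearSum d W j)
    (hWS : ∀ i ≤ d, ∀ v ∈ W i, S v = (b * weight q d i + b⁻¹ * (weight q d i)⁻¹) • v)
    (hΨu : IsUnit Ψ) (hΨA : Ψ * A = A * Ψ)
    (hΨ : ∀ i ≤ d, ∀ v ∈ eigenspaceSeq A θ i, Ψ v = lusztigWeight q a d i • v) :
    SplitConfig q a b d (partialSum W) (partialSum (inversion d (eigenspaceSeq A θ)))
      (partialSum (eigenspaceSeq A θ)) A S Ψ (fun n => lusztigWeight q a d (d - n))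
      (lusztigWeight q a d) := by
  have hθ' : ∀ i ≤ d, a⁻¹ * (weight q d i)⁻¹ + a * weight q d i = θ i := fun i hi => by
    rw [hθ i hi, add_comm]
  have hθr : ∀ i ≤ d, a * (weight q d i)⁻¹ + a⁻¹ * weight q d i = θ (d - i) := fun i hi => by
    rw [hθ _ (Nat.sub_le _ _), weight_sub hi, inv_inv]
  have hA : ∀ i, ∀ v ∈ eigenspaceSeq A θ i, A v = θ i • v := fun i v hv =>
    Module.End.mem_eigenspace_iff.1 hv
  have tri := hW.triangular hWS
  exact
  { q_ne := hq0
    q_pow := hq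
    a_ne := ha
    a_sub := ha2
    b_ne := hb
    irr := hirr
    G_one := hW.partialSum_one_ne_bot
    G_top := hW.partialSum_ne_top
    H_top := hE.inversion.partialSum_ne_top
    H_top' := hE.partialSum_ne_top
    tri := ⟨hW.isFlag, hE.inversion.isFlag, tri, hE.inversion.triangular fun i hi v hv => by
      rw [hθr i hi]; exact hA _ v hv, partialSum_raise hW hWA,
      partialSum_raise hE.inversion (nearSum_inversion hES)⟩
    tri' := ⟨hW.isFlag, hE.isFlag, tri, hE.triangular fun i hi v hv => by
      rw [hθ' i hi]; exact hA _ v hv, partialSum_raise hW hWA, partialSum_raise hE hES⟩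
    inj := fun i j hij hj he => by
      rw [hθr i (by omega), hθr j hj] at he
      have := hinj _ (Nat.sub_le _ _) _ (Nat.sub_le _ _) he
      omega
    inj' := fun i j hij hj he => by
      rw [hθ' i (by omega), hθ' j hj] at he
      have := hinj _ (by omega) _ hj he
      omega
    unit := hΨu
    comm := hΨA
    trit := hE.inversion.triangular fun i _ v hv => hΨ (d - i) (Nat.sub_le _ _) v hv
    trit' := hE.triangular hΨ
    t_succ := fun n hn => lusztigWeight_sub hq0 ha hn
    t_succ' := fun n _ => lusztigWeight_succ hq0 a d n }

namespace SplitConfig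

variable [FiniteDimensional F V] {G H H' : ℕ → Submodule F V} {t t' : ℕ → F}
  {K B : Module.End F V}

theorem links_inverse (h : SplitConfig q a b d G H H' A S Ψ t t') (hK : Links q d G H K) :
    Links q d H G (Ring.inverse K) :=
  hK.symm h.q_ne h.tri.flagG h.tri.flagH (Ring.inverse_mul_cancel K (h.isUnit hK))

theorem links_lower (h : SplitConfig q a b d G H H' A S Ψ t t') (hK : Links q d G H K) :
    Links q d (lowerFlag Ψ G) H (a⁻¹ • A - (a ^ 2)⁻¹ • Ring.inverse K) :=
  h.links_shift hK (Ring.inverse_mul_cancel K (h.isUnit hK))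
    (Ring.mul_inverse_cancel K (h.isUnit hK))

theorem links_lower_swap (h : SplitConfig q a b d G H H' A S Ψ t t') (hB : Links q d G H' B) :
    Links q d (lowerFlag Ψ G) H' (a • A - a ^ 2 • Ring.inverse B) := by
  have := h.swap.links_lower hB
  rwa [inv_inv, inv_pow, inv_inv] at this

theorem links_mapN_inverse (h : SplitConfig q a b d G H H' A S Ψ t t') (hK : Links q d G H K)
    (hB : Links q d G H' B) (hL : IsFlag d (lowerFlag Ψ G)) :
    Links q d G (lowerFlag Ψ G) (Ring.inverse (mapN a K B)) := by
  have hKu := h.isUnit hK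
  have hBu := h.swap.isUnit hB
  exact (h.links_mapN hK hB (Ring.inverse_mul_cancel K hKu) (Ring.mul_inverse_cancel K hKu)
    (Ring.inverse_mul_cancel B hBu) (Ring.mul_inverse_cancel B hBu)).symm h.q_ne hL h.tri.flagG
    (Ring.inverse_mul_cancel _ (h.isUnit_mapN hK hB))

end SplitConfig

theorem IsEquitableTriple.rotate {X Y Z : Module.End F V} (h : IsEquitableTriple q X Y Z) :
    IsEquitableTriple q Y Z X :=
  ⟨h.2.1, h.2.2.1, h.1, h.2.2.2.2.1, h.2.2.2.2.2, h.2.2.2.1⟩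

theorem ncard_orientedThreeCycles :
    {c : Cycle Vertex | ∃ x y z, IsOrientedThreeCycle x y z ∧
      c = (([x, y, z] : List Vertex) : Cycle Vertex)}.ncard = 4 := by
  have h : {c : Cycle Vertex | ∃ x y z, IsOrientedThreeCycle x y z ∧
      c = (([x, y, z] : List Vertex) : Cycle Vertex)} =
      (({(([.topLeft, .botLeft, .midLeft] : List Vertex) : Cycle Vertex),
        (([.topLeft, .botLeft, .midRight] : List Vertex) : Cycle Vertex),
        (([.topRight, .botRight, .midLeft] : List Vertex) : Cycle Vertex),
        (([.topRight, .botRight, .midRight] : List Vertex) : Cycle Vertex)} : Finset (Cycle Vertex)) :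
        Set (Cycle Vertex)) := by
    ext c
    simp only [Set.mem_ofPred_eq, Finset.coe_insert, Finset.coe_singleton, Set.mem_insert_iff,
      Set.mem_singleton_iff]
    constructor
    · rintro ⟨x, y, z, ⟨h1, h2, h3⟩, rfl⟩
      cases h1 <;> cases h2 <;> cases h3 <;> decide
    · rintro (rfl | rfl | rfl | rfl)
      · exact ⟨_, _, _, ⟨.topLeft_botLeft, .botLeft_midLeft, .midLeft_topLeft⟩, rfl⟩
      · exact ⟨_, _, _, ⟨.topLeft_botLeft, .botLeft_midRight, .midRight_topLeft⟩, rfl⟩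
      · exact ⟨_, _, _, ⟨.topRight_botRight, .botRight_midLeft, .midLeft_topRight⟩, rfl⟩
      · exact ⟨_, _, _, ⟨.topRight_botRight, .botRight_midRight, .midRight_topRight⟩, rfl⟩
  rw [h, Set.ncard_coe_finset]
  decide

/-- Both members of an irreducible pair have the same number of eigenvalues. -/
theorem diameter_eq {δ : ℕ} {θs : ℕ → F} (hirr : IsIrreduciblePair A S)
    (hE : IsDecomposition d (eigenspaceSeq A θ)) (hEs : IsDecomposition δ (eigenspaceSeq S θs))
    (hES : ∀ j ≤ d, ∀ v ∈ eigenspaceSeq A θ j, S v ∈ nearSum d (eigenspaceSeq A θ) j)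
    (hEA : ∀ j ≤ δ, ∀ v ∈ eigenspaceSeq S θs j, A v ∈ nearSum δ (eigenspaceSeq S θs) j) :
    δ = d := by
  have h : IsTridiagonal δ d (partialSum (eigenspaceSeq S θs)) (partialSum (eigenspaceSeq A θ))
      θs θ A S :=
    ⟨hEs.isFlag, hE.isFlag, hEs.triangular fun i _ v hv => Module.End.mem_eigenspace_iff.1 hv,
      hE.triangular fun i _ v hv => Module.End.mem_eigenspace_iff.1 hv,
      partialSum_raise hEs hEA, partialSum_raise hE hES⟩
  exact le_antisymm
    (h.symm.le_of_irreducible hirr.symm hEs.partialSum_ne_top hEs.partialSum_one_ne_bot)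
    (h.le_of_irreducible hirr hE.partialSum_ne_top hE.partialSum_one_ne_bot)

/-- The diagram of a pair of endomorphisms satisfying the q-Dolan/Grady relations. -/
theorem diagram_of_pair [FiniteDimensional F V] (hq0 : q ≠ 0) (hq : ∀ n : ℕ, 0 < n → q ^ n ≠ 1)
    (hirr : IsIrreduciblePair A S) (hdim : 2 ≤ Module.finrank F V)
    (hA : IsDiagonalizable A) (hS : IsDiagonalizable S)
    (hAS : DolanGrady q A S) (hSA : DolanGrady q S A) (d δ : ℕ) (θ θs : ℕ → F)
    (hθ : IsStandardOrdering q A d θ) (hθs : IsStandardOrdering q S δ θs)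
    (D : Vertex → ℕ → Submodule F V)
    (hD : D = startingAt d (eigenspaceSeq A θ) (eigenspaceSeq S θs)
      (eigenspaceSeq (lusztig q A S) θs)) :
    δ = d ∧ (∀ x, IsDecomposition d (D x)) ∧
    ∃ a : F, a ≠ 0 ∧ a - a⁻¹ ≠ 0 ∧
      (∀ i ≤ d, θ i =
        a * q ^ ((d : ℤ) - 2 * (i : ℤ)) + a⁻¹ * q ^ (2 * (i : ℤ) - (d : ℤ))) ∧
      ∃ K B Kd Bd : Module.End F V,
        IsEdgeMap q d D .topLeft .midRight K ∧ IsEdgeMap q d D .topLeft .midLeft B ∧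
        IsEdgeMap q d D .topRight .midRight Kd ∧ IsEdgeMap q d D .topRight .midLeft Bd ∧
        IsUnit K ∧ IsUnit B ∧ IsUnit Kd ∧ IsUnit Bd ∧
        IsUnit (mapN a K B) ∧ IsUnit (mapN a Kd Bd) ∧
        (∀ x y, Edge x y → ∀ X : Module.End F V,
          IsEdgeMap q d D x y X ↔ X = edgeLabel a A K B Kd Bd x y) ∧
        {c : Cycle Vertex | ∃ x y z, IsOrientedThreeCycle x y z ∧
            c = (([x, y, z] : List Vertex) : Cycle Vertex)}.ncard = 4 ∧
        (∀ x y z, IsOrientedThreeCycle x y z → ∀ X Y Z : Module.End F V,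
          IsEdgeMap q d D x y X → IsEdgeMap q d D y z Y →
          IsEdgeMap q d D z x Z → IsEquitableTriple q X Y Z) := by
  have hd := one_le_of_irreducible hirr hdim hA hθ (hθs.hasEigenvalue 0 (Nat.zero_le _))
  have hδ := one_le_of_irreducible hirr.symm hdim hS hθs (hθ.hasEigenvalue 0 (Nat.zero_le _))
  obtain ⟨a, ha, ha2, hθa⟩ := exists_parameter hq0 hq hd hθ
  obtain ⟨b, hb, -, hθb⟩ := exists_parameter hq0 hq hδ hθs
  have hE := isDecomposition_eigenspaceSeq hθ hA
  have hEs := isDecomposition_eigenspaceSeq hθs hS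
  have hES := hAS.mem_nearSum hq0 hq hE ha hθa hθ.injective
  have hEA := hSA.mem_nearSum hq0 hq hEs hb hθb hθs.injective
  obtain rfl := diameter_eq hirr hE hEs hES hEA
  obtain ⟨Ψ, hΨu, hΨA, hΨ⟩ := exists_lusztig_map hE hθ.injective (lusztigWeight q a δ)
    (lusztigWeight_ne_zero hq0 ha δ)
  have hLA := lusztig_conj hq0 hq hE ha hθa hES hΨ
  have hSv : ∀ i, ∀ v ∈ eigenspaceSeq S θs i, S v = θs i • v := fun i v hv =>
    Module.End.mem_eigenspace_iff.1 hv
  have cl := splitConfig hq0 hq ha ha2 hb hirr hE hθa hθ.injective hES hEs hEA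
    (fun i hi v hv => by rw [← hθb i hi]; exact hSv i v hv) hΨu hΨA hΨ
  -- The right half of the diagram: reversing the eigenspaces of A* inverts `b`, while `a` and `Ψ`
  -- are unchanged.
  have cr := splitConfig (b := b⁻¹) hq0 hq ha ha2 (inv_ne_zero hb) hirr hE hθa hθ.injective hES
    hEs.inversion (nearSum_inversion hEA)
    (fun i hi v hv => by
      rw [hSv _ v hv, hθb _ (Nat.sub_le _ _), weight_sub hi, inv_inv, inv_inv, add_comm])
    hΨu hΨA hΨ
  rw [eigenspaceSeq_conj hΨu hLA] at hD
  have hdec : ∀ x, IsDecomposition δ (D x) := by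
    rw [hD]
    rintro (_ | _ | _ | _ | _ | _)
    exacts [hEs, hEs.inversion, hE, hE.inversion, hEs.map hΨu, hEs.inversion.map hΨu]
  have pbl : partialSum (D .botLeft) = SplitConfig.lowerFlag Ψ (partialSum (D .topLeft)) := by
    rw [hD]; exact partialSum_map Ψ _
  have pbr : partialSum (D .botRight) = SplitConfig.lowerFlag Ψ (partialSum (D .topRight)) := by
    rw [hD]; exact partialSum_map Ψ _
  have cl' : SplitConfig q a b δ (partialSum (D .topLeft)) (partialSum (D .midRight))
      (partialSum (D .midLeft)) A S Ψ (fun n => lusztigWeight q a δ (δ - n))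
      (lusztigWeight q a δ) := by rw [hD]; exact cl
  have cr' : SplitConfig q a b⁻¹ δ (partialSum (D .topRight)) (partialSum (D .midRight))
      (partialSum (D .midLeft)) A S Ψ (fun n => lusztigWeight q a δ (δ - n))
      (lusztigWeight q a δ) := by rw [hD]; exact cr
  obtain ⟨K, hK⟩ := cl'.exists_links
  obtain ⟨B, hB⟩ := cl'.swap.exists_links
  obtain ⟨Kd, hKd⟩ := cr'.exists_links
  obtain ⟨Bd, hBd⟩ := cr'.swap.exists_links
  have iff_links := fun x y (X : Module.End F V) =>
    isEdgeMap_iff (D := D) (x := x) (y := y) (X := X) hq0 hq (hdec x) (hdec y)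
  have hlabel : ∀ x y, Edge x y → ∀ X : Module.End F V,
      IsEdgeMap q δ D x y X ↔ X = edgeLabel a A K B Kd Bd x y := by
    have hlinks : ∀ x y, Edge x y →
        Links q δ (partialSum (D x)) (partialSum (D y)) (edgeLabel a A K B Kd Bd x y) := by
      intro x y hxy
      cases hxy with
      | midLeft_topLeft => exact cl'.swap.links_inverse hB
      | midRight_topLeft => exact cl'.links_inverse hK
      | midLeft_topRight => exact cr'.swap.links_inverse hBd
      | midRight_topRight => exact cr'.links_inverse hKd
      | botLeft_midLeft => rw [pbl]; exact cl'.links_lower_swap hB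
      | botLeft_midRight => rw [pbl]; exact cl'.links_lower hK
      | botRight_midLeft => rw [pbr]; exact cr'.links_lower_swap hBd
      | botRight_midRight => rw [pbr]; exact cr'.links_lower hKd
      | topLeft_botLeft =>
        have hf := (hdec .botLeft).isFlag
        rw [pbl] at hf ⊢
        exact cl'.links_mapN_inverse hK hB hf
      | topRight_botRight =>
        have hf := (hdec .botRight).isFlag
        rw [pbr] at hf ⊢
        exact cr'.links_mapN_inverse hKd hBd hf
    intro x y hxy X
    rw [iff_links]
    constructor
    · exact fun h => h.unique hq0 hq (hdec x).isFlag (hdec y).isFlag (hlinks x y hxy)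
    · rintro rfl
      exact hlinks x y hxy
  refine ⟨rfl, hdec, a, ha, ha2, fun i hi => ?_, K, B, Kd, Bd, (iff_links _ _ _).2 hK,
    (iff_links _ _ _).2 hB, (iff_links _ _ _).2 hKd, (iff_links _ _ _).2 hBd, cl'.isUnit hK,
    cl'.swap.isUnit hB, cr'.isUnit hKd, cr'.swap.isUnit hBd, cl'.isUnit_mapN hK hB,
    cr'.isUnit_mapN hKd hBd, hlabel, ncard_orientedThreeCycles, ?_⟩
  · rw [hθa i hi, weight_inv, weight]
  · rintro x y z ⟨hxy, hyz, hzx⟩ X Y Z hX hY hZ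
    rw [hlabel x y hxy] at hX
    rw [hlabel y z hyz] at hY
    rw [hlabel z x hzx] at hZ
    subst hX hY hZ
    have t1 := cl'.isEquitableTriple hK hB
    have t2 := cl'.isEquitableTriple_swap hK hB
    have t3 := cr'.isEquitableTriple hKd hBd
    have t4 := cr'.isEquitableTriple_swap hKd hBd
    cases hxy <;> cases hyz <;> cases hzx <;>
      first
        | exact t1
        | exact t2
        | exact t3
        | exact t4
        | exact t1.rotate
        | exact t2.rotate
        | exact t3.rotate
        | exact t4.rotate
        | exact t1.rotate.rotate
        | exact t2.rotate.rotate
        | exact t3.rotate.rotate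
        | exact t4.rotate.rotate

end Assembly

end OnsagerDiagram

/-! ### From modules over the q-Onsager algebra to pairs of operators -/

namespace QOnsager

open OnsagerDiagram

variable {F : Type*} [Field F] {q : F} {V : Type*} [AddCommGroup V] [Module F V]
  [Module (QOnsager F q) V] [IsScalarTower F (QOnsager F q) V]

theorem act_ringComm (x y : QOnsager F q) :
    act V (ringComm x y) = ringComm (act V x) (act V y) := by
  simp only [act, ringComm, map_sub, map_mul]

theorem act_qComm (c : F) (x y : QOnsager F q) :
    act V (qComm c x y) = qComm c (act V x) (act V y) := by
  simp only [act, qComm, map_sub, map_mul, map_smul]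

theorem mkAlgHom_ringComm (x y : FreeAlgebra F (Fin 2)) :
    RingQuot.mkAlgHom F (DolanGradyRel F q) (ringComm x y) =
      ringComm (RingQuot.mkAlgHom F (DolanGradyRel F q) x)
        (RingQuot.mkAlgHom F (DolanGradyRel F q) y) := by
  simp only [ringComm, map_sub, map_mul]

theorem mkAlgHom_qComm (c : F) (x y : FreeAlgebra F (Fin 2)) :
    RingQuot.mkAlgHom F (DolanGradyRel F q) (qComm c x y) =
      qComm c (RingQuot.mkAlgHom F (DolanGradyRel F q) x)
        (RingQuot.mkAlgHom F (DolanGradyRel F q) y) := by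
  simp only [qComm, map_sub, map_mul, map_smul]

variable (V) in
theorem dolanGrady_first : DolanGrady q (act V (A q)) (act V (Astar q)) := by
  have h := RingQuot.mkAlgHom_rel F (DolanGradyRel.first (F := F) (q := q))
  simp only [mkAlgHom_ringComm, mkAlgHom_qComm, map_smul] at h
  have h' := congrArg (act V) h
  rw [DolanGrady, ← act_qComm, ← act_qComm, ← act_ringComm, ← act_ringComm]
  exact h'.trans (map_smul (Algebra.lsmul F F V) _ _)

variable (V) in
theorem dolanGrady_second : DolanGrady q (act V (Astar q)) (act V (A q)) := by
  have h := RingQuot.mkAlgHom_rel F (DolanGradyRel.second (F := F) (q := q))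
  simp only [mkAlgHom_ringComm, mkAlgHom_qComm, map_smul] at h
  have h' := congrArg (act V) h
  rw [DolanGrady, ← act_qComm, ← act_qComm, ← act_ringComm, ← act_ringComm]
  exact h'.trans (map_smul (Algebra.lsmul F F V) _ _)

variable (V) in
theorem act_LAstar : act V (LAstar q) = lusztig q (act V (A q)) (act V (Astar q)) := by
  rw [lusztig, ← act_qComm, ← act_ringComm]
  simp only [LAstar, act, map_add, map_smul]

/-- The algebra is a quotient of the free algebra on the two generators, so a subspace stable under
both is a submodule. -/
theorem isIrreduciblePair (hirr : IsSimpleModule (QOnsager F q) V) :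
    IsIrreduciblePair (act V (A q)) (act V (Astar q)) := by
  intro M hA hS
  have key : ∀ y : FreeAlgebra F (Fin 2), ∀ v ∈ M,
      RingQuot.mkAlgHom F (DolanGradyRel F q) y • v ∈ M := by
    intro y
    induction y using FreeAlgebra.induction with
    | grade0 r =>
      intro v hv
      rw [AlgHom.commutes, algebraMap_smul]
      exact M.smul_mem r hv
    | grade1 i =>
      intro v hv
      fin_cases i
      · exact hA v hv
      · exact hS v hv
    | mul x y hx hy =>
      intro v hv
      rw [map_mul, mul_smul]
      exact hx _ (hy v hv)
    | add x y hx hy =>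
      intro v hv
      rw [map_add, add_smul]
      exact M.add_mem (hx v hv) (hy v hv)
  let M' : Submodule (QOnsager F q) V :=
    { M.toAddSubmonoid with
      smul_mem' := fun x v hv => by
        obtain ⟨y, rfl⟩ := RingQuot.mkAlgHom_surjective F (DolanGradyRel F q) x
        exact key y v hv }
  have hmem : ∀ v, v ∈ M' ↔ v ∈ M := fun _ => Iff.rfl
  rcases eq_bot_or_eq_top M' with h | h
  · left
    ext v
    rw [← hmem, h, Submodule.mem_bot, Submodule.mem_bot]
  · right
    ext v
    rw [← hmem, h]
    simp

end QOnsager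

theorem theorem8p2 {F : Type*} [Field F] (q : F) (hq0 : q ≠ 0)
    (hq : ∀ n : ℕ, 0 < n → q ^ n ≠ 1)
    {V : Type*} [AddCommGroup V] [Module F V] [Module (QOnsager F q) V]
    [IsScalarTower F (QOnsager F q) V] [FiniteDimensional F V]
    (hirr : IsSimpleModule (QOnsager F q) V) (hdim : 2 ≤ Module.finrank F V)
    (hA : OnsagerDiagram.IsDiagonalizable (QOnsager.act V (QOnsager.A q)))
    (hAs : OnsagerDiagram.IsDiagonalizable (QOnsager.act V (QOnsager.Astar q)))
    (d δ : ℕ) (θ θs : ℕ → F)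
    (hθ : OnsagerDiagram.IsStandardOrdering q (QOnsager.act V (QOnsager.A q)) d θ)
    (hθs : OnsagerDiagram.IsStandardOrdering q (QOnsager.act V (QOnsager.Astar q)) δ θs)
    (D : OnsagerDiagram.Vertex → ℕ → Submodule F V)
    -- `D x` is the eigenspace decomposition of `A*`, `A` or `L(A*)` that starts at the vertex `x`
    (hD : D = OnsagerDiagram.startingAt d
      (OnsagerDiagram.eigenspaceSeq (QOnsager.act V (QOnsager.A q)) θ)
      (OnsagerDiagram.eigenspaceSeq (QOnsager.act V (QOnsager.Astar q)) θs)
      (OnsagerDiagram.eigenspaceSeq (QOnsager.act V (QOnsager.LAstar q)) θs)) :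
    δ = d ∧ (∀ x, OnsagerDiagram.IsDecomposition d (D x)) ∧
    ∃ a : F, a ≠ 0 ∧ a - a⁻¹ ≠ 0 ∧
      (∀ i ≤ d, θ i =
        a * q ^ ((d : ℤ) - 2 * (i : ℤ)) + a⁻¹ * q ^ (2 * (i : ℤ) - (d : ℤ))) ∧
      ∃ K B Kd Bd : Module.End F V,
        -- `K`, `B`, `K↓`, `B↓` are the maps of the split decompositions for `A`, `A*`
        OnsagerDiagram.IsEdgeMap q d D .topLeft .midRight K ∧
        OnsagerDiagram.IsEdgeMap q d D .topLeft .midLeft B ∧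
        OnsagerDiagram.IsEdgeMap q d D .topRight .midRight Kd ∧
        OnsagerDiagram.IsEdgeMap q d D .topRight .midLeft Bd ∧
        IsUnit K ∧ IsUnit B ∧ IsUnit Kd ∧ IsUnit Bd ∧
        IsUnit (OnsagerDiagram.mapN a K B) ∧ IsUnit (OnsagerDiagram.mapN a Kd Bd) ∧
        -- each oriented edge represents exactly one map, namely its label
        (∀ x y, OnsagerDiagram.Edge x y → ∀ X : Module.End F V,
          OnsagerDiagram.IsEdgeMap q d D x y X ↔
            X = OnsagerDiagram.edgeLabel a (QOnsager.act V (QOnsager.A q)) K B Kd Bd x y) ∧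
        -- there are four oriented 3-cycles
        {c : Cycle OnsagerDiagram.Vertex | ∃ x y z,
          OnsagerDiagram.IsOrientedThreeCycle x y z ∧
            c = (([x, y, z] : List OnsagerDiagram.Vertex) : Cycle OnsagerDiagram.Vertex)}.ncard
          = 4 ∧
        -- for each of them, the corresponding maps form an equitable triple
        (∀ x y z, OnsagerDiagram.IsOrientedThreeCycle x y z → ∀ X Y Z : Module.End F V,
          OnsagerDiagram.IsEdgeMap q d D x y X → OnsagerDiagram.IsEdgeMap q d D y z Y →
          OnsagerDiagram.IsEdgeMap q d D z x Z → OnsagerDiagram.IsEquitableTriple q X Y Z) := by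
  rw [QOnsager.act_LAstar] at hD
  exact OnsagerDiagram.diagram_of_pair hq0 hq (QOnsager.isIrreduciblePair hirr) hdim hA hAs
    (QOnsager.dolanGrady_first V) (QOnsager.dolanGrady_second V) d δ θ θs hθ hθs D hD
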